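/- Let $p$ be a prime number. For a Noetherian local ring $(R,\mathfrak m)$ of dimension $d$, a parameter ideal is an $\mathfrak m$-primary ideal generated by $d$ elements. For a parameter ideal $Q$, the Hilbert coefficients $e_i(Q)\in\mathbb Z$ are defined by $$\ell(R/Q^{n+1})=\sum_{i=0}^{d}(-1)^i e_i(Q)\binom{n+d-i}{d-i}\quad\text{for all } n\gg 0.$$ If $R$ has characteristic $p$, the tight closure $I^*$ of an ideal $I$ consists of all $x\in R$ for which there is $c\in R$ outside every minimal prime of $R$ with $c\,x^{p^e}\in I^{[p^e]}$ for all $e\gg 0$, where $I^{[p^e]}$ is the ideal generated by the $p^e$-th powers of the elements of $I$. The tight Hilbert coefficients $e_i^*(Q)$ are defined in the same way as the $e_i(Q)$, with $(Q^{n+1})^*$ in place of $Q^{n+1}$. The ring $R$ is $F$-rational if $Q^*=Q$ for every parameter ideal $Q$; it is Buchsbaum if $\ell(R/Q)-e_0(Q)$ is the same number for all parameter ideals $Q$; it is generalized Cohen–Macaulay if $\ell(R/Q)-e_0(Q)$ is bounded above, uniformly in $Q$. An $R$-module $M$ satisfies $(S_2)$ if $\operatorname{depth} M_P\ge\min\{2,\dim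 M_P\}$ for every prime $P$ of $R$. An $S_2$-ification of $R$ is a ring $S$ between $R$ and its total quotient ring which is finite as an $R$-module, satisfies $(S_2)$ as an $R$-module, and is such that for every $s\in S\setminus R$ the ideal $\{r\in R: rs\in R\}$ has height at least two. Now let $$R=\mathbb F_p[[X^5,X^4Y,XY^4,Y^5]]\subset S=\mathbb F_p[[X^5,X^4Y,X^3Y^2,X^2Y^3,XY^4,Y^5]]\subset\mathbb F_p[[X,Y]].$$ Then: 1. $R$ is a complete Noetherian local domain of characteristic $p$ with maximal ideal $\mathfrak m=(X^5,X^4Y,XY^4,Y^5)$, $\dim R=\dim S=2$, and $S$ is an $S_2$-ification of $R$. 2. $R$ does not satisfy $(S_2)$ and is not Buchsbaum, but it is generalized Cohen–Macaulay. 3. $Q=(X^5,Y^5)$ is a parameter ideal of $R$, and its Hilbert and tight Hilbert coefficients exist and satisfy $e_0(Q)-\ell(R/Q^*)+e_1(Q)=0$ and $$\ell\bigl(R/(Q^{n+1})^*\bigr)=e_0(Q)\binom{n+2}{2}-4\quad\text{for all } n\gg 0;$$ in particular $e_1^*(Q)=0$. 4. $R$ is not $F$-rational. Hence, even for complete local domains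 of characteristic $p$, the vanishing of $e_1^*(Q)$ for a parameter ideal $Q$ does not imply that $R$ is $F$-rational if one assumes neither $(S_2)$ nor the Buchsbaum property. -/

import Mathlib

namespace TightHilbert

open MvPowerSeries

/-! ### Tight closure, parameter ideals, Hilbert coefficients -/

section General

variable {R : Type*} [CommRing R]

/-- The tight closure `I^*` of an ideal of a ring of prime characteristic `p`: all `x` for which
some `c` outside every minimal prime of `R` satisfies `c * x ^ (p ^ e) ∈ I^[p ^ e]` for all
`e ≫ 0`, where the Frobenius power `I^[p ^ e]` is the ideal generated by the `p ^ e`-th powers of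
the elements of `I`. -/
def tightClosure (p : ℕ) [Fact p.Prime] [CharP R p] (I : Ideal R) : Ideal R where
  carrier := {x | ∃ c : R, (∀ P ∈ minimalPrimes R, c ∉ P) ∧
    ∀ᶠ e : ℕ in Filter.atTop, c * x ^ p ^ e ∈ Ideal.span ((fun a : R => a ^ p ^ e) '' (I : Set R))}
  zero_mem' := by
    refine ⟨1, fun P hP h => ?_, Filter.Eventually.of_forall fun e => ?_⟩
    · have : P.IsPrime := hP.1.1
      exact this.ne_top ((Ideal.eq_top_iff_one P).2 h)
    · have : p ^ e ≠ 0 := pow_ne_zero _ (Fact.out : p.Prime).ne_zero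
      simp [zero_pow this]
  add_mem' := by
    rintro x y ⟨c, hc, hx⟩ ⟨d, hd, hy⟩
    refine ⟨c * d, fun P hP h => ?_, ?_⟩
    · have : P.IsPrime := hP.1.1
      exact (this.mem_or_mem h).elim (hc P hP) (hd P hP)
    · filter_upwards [hx, hy] with e hx hy
      have : c * d * (x + y) ^ p ^ e = d * (c * x ^ p ^ e) + c * (d * y ^ p ^ e) := by
        rw [add_pow_char_pow]; ring
      rw [this]
      exact add_mem (Ideal.mul_mem_left _ _ hx) (Ideal.mul_mem_left _ _ hy)
  smul_mem' := by
    rintro r x ⟨c, hc, hx⟩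
    refine ⟨c, hc, ?_⟩
    filter_upwards [hx] with e hx
    have : c * (r • x) ^ p ^ e = r ^ p ^ e * (c * x ^ p ^ e) := by
      rw [smul_eq_mul, mul_pow]; ring
    rw [this]
    exact Ideal.mul_mem_left _ _ hx

/-- A parameter ideal of a local ring of dimension `d`: an ideal primary to the maximal ideal and
generated by `d` elements, that is, by a system of parameters. -/
def IsParameterIdeal [IsLocalRing R] (Q : Ideal R) : Prop :=
  ∃ d : ℕ, ringKrullDim R = d ∧ ∃ x : Fin d → R,
    Q = Ideal.span (Set.range x) ∧ Q.radical = IsLocalRing.maximalIdeal R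

/-- `e 0, …, e d` are the coefficients of the polynomial that gives the length of `R / J n` for all
`n ≫ 0`, in the normalization
`ℓ(R / J n) = e 0 * (n + d).choose d - e 1 * (n + d - 1).choose (d - 1) + ⋯ + (-1) ^ d * e d`.
(They are determined by `J` and `d`.) -/
def IsHilbertCoeffs (J : ℕ → Ideal R) {d : ℕ} (e : Fin (d + 1) → ℤ) : Prop :=
  ∀ᶠ n : ℕ in Filter.atTop, ∃ l : ℕ, Module.length R (R ⧸ J n) = l ∧
    (l : ℤ) = ∑ i : Fin (d + 1), (-1) ^ (i : ℕ) * e i * ((n + d - i).choose (d - i) : ℤ)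

/-- The Hilbert coefficients `e_0(I), …, e_d(I)`. -/
def HasHilbertCoeffs (I : Ideal R) {d : ℕ} (e : Fin (d + 1) → ℤ) : Prop :=
  IsHilbertCoeffs (fun n => I ^ (n + 1)) e

/-- The tight Hilbert coefficients `e_0^*(I), …, e_d^*(I)`. -/
def HasTightHilbertCoeffs (p : ℕ) [Fact p.Prime] [CharP R p] (I : Ideal R) {d : ℕ}
    (e : Fin (d + 1) → ℤ) : Prop :=
  IsHilbertCoeffs (fun n => tightClosure p (I ^ (n + 1))) e

variable (R) in
/-- `R` is Buchsbaum: `ℓ(R / Q) - e_0(Q)` does not depend on the parameter ideal `Q`. -/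
def IsBuchsbaum [IsLocalRing R] : Prop :=
  ∃ C : ℤ, ∀ Q : Ideal R, IsParameterIdeal Q → ∀ (d : ℕ) (e : Fin (d + 1) → ℤ) (l : ℕ),
    ringKrullDim R = d → HasHilbertCoeffs Q e → Module.length R (R ⧸ Q) = l → (l : ℤ) - e 0 = C

variable (R) in
/-- `R` is generalized Cohen-Macaulay: `ℓ(R / Q) - e_0(Q)` is bounded above, uniformly in the
parameter ideal `Q`. -/
def IsGeneralizedCohenMacaulay [IsLocalRing R] : Prop :=
  ∃ C : ℤ, ∀ Q : Ideal R, IsParameterIdeal Q → ∀ (d : ℕ) (e : Fin (d + 1) → ℤ) (l : ℕ),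
    ringKrullDim R = d → HasHilbertCoeffs Q e → Module.length R (R ⧸ Q) = l → (l : ℤ) - e 0 ≤ C

variable (R) in
/-- `R` is `F`-rational: every parameter ideal is tightly closed. -/
def IsFRational (p : ℕ) [Fact p.Prime] [CharP R p] [IsLocalRing R] : Prop :=
  ∀ Q : Ideal R, IsParameterIdeal Q → tightClosure p Q = Q

variable (R) in
/-- Serre's condition `(S_n)` for a module `M`: `depth M_P ≥ min (n, dim M_P)` for all primes `P`,
i.e. for every `k ≤ min (n, dim M_P)` there is an `M_P`-regular sequence of length `k` in the
maximal ideal of `R_P`. -/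
def SatisfiesSerre (n : ℕ) (M : Type*) [AddCommGroup M] [Module R M] : Prop :=
  ∀ (P : Ideal R) [P.IsPrime] (k : ℕ), k ≤ n →
    (k : WithBot ℕ∞) ≤
      Module.supportDim (Localization.AtPrime P) (LocalizedModule P.primeCompl M) →
    ∃ rs : List (Localization.AtPrime P), rs.length = k ∧
      (∀ r ∈ rs, r ∈ IsLocalRing.maximalIdeal (Localization.AtPrime P)) ∧
      RingTheory.Sequence.IsRegular (LocalizedModule P.primeCompl M) rs

variable (R) in
/-- `S` is an `S_2`-ification of `R`: it lies between `R` and its total quotient ring, is finite and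
`(S_2)` as an `R`-module, and for every `s ∈ S \ R` the ideal `{r ∈ R | r s ∈ R}` has height at
least two. -/
def IsS2ification (S : Type*) [CommRing S] [Algebra R S] : Prop :=
  (∃ f : S →ₐ[R] FractionRing R, Function.Injective f) ∧
  Module.Finite R S ∧ SatisfiesSerre R 2 S ∧
  ∀ s : S, s ∉ Set.range (algebraMap R S) →
    2 ≤ Ideal.height
      ((LinearMap.range (Algebra.linearMap R S)).comap (LinearMap.toSpanSingleton R S s))

end General

/-! ### Rings of formal power series in given monomials -/

/-- The ring `k[[H]]` of formal power series all of whose exponents lie in the monoid `H`. If `H` is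
generated by `h₁, …, hᵣ`, these are exactly the power series in the monomials with exponents
`h₁, …, hᵣ`, so this is the ring `k[[X^h₁, …, X^hᵣ]]`. -/
def powerSeriesSubalgebra (k : Type*) [CommRing k] {σ : Type*} (H : AddSubmonoid (σ →₀ ℕ)) :
    Subalgebra k (MvPowerSeries σ k) where
  carrier := {f | ∀ n, coeff n f ≠ 0 → n ∈ H}
  mul_mem' := by
    classical
    intro f g hf hg n hn
    rw [coeff_mul] at hn
    obtain ⟨⟨a, b⟩, hab, h⟩ := Finset.exists_ne_zero_of_sum_ne_zero hn
    rw [← Finset.HasAntidiagonal.mem_antidiagonal.1 hab]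
    exact H.add_mem (hf a (left_ne_zero_of_mul h)) (hg b (right_ne_zero_of_mul h))
  add_mem' := by
    intro f g hf hg n hn
    by_cases h : coeff n f = 0
    · exact hg n (by simpa [h] using hn)
    · exact hf n h
  algebraMap_mem' := by
    classical
    intro r n hn
    rw [MvPowerSeries.algebraMap_apply, coeff_C] at hn
    by_cases h : n = 0
    · exact h ▸ H.zero_mem
    · simp [h] at hn

/-- The exponent `(a, b)` of the monomial `X ^ a * Y ^ b`. -/
noncomputable def expo (a b : ℕ) : Fin 2 →₀ ℕ := Finsupp.single 0 a + Finsupp.single 1 b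

/-- The exponents generated by those of `X^5, X^4 Y, X Y^4, Y^5`. -/
noncomputable def monoidR : AddSubmonoid (Fin 2 →₀ ℕ) :=
  AddSubmonoid.closure {expo 5 0, expo 4 1, expo 1 4, expo 0 5}

/-- The exponents generated by those of `X^5, X^4 Y, X^3 Y^2, X^2 Y^3, X Y^4, Y^5`. -/
noncomputable def monoidS : AddSubmonoid (Fin 2 →₀ ℕ) :=
  AddSubmonoid.closure {expo 5 0, expo 4 1, expo 3 2, expo 2 3, expo 1 4, expo 0 5}

/-- `F_p[[X^5, X^4 Y, X Y^4, Y^5]]`. -/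
noncomputable abbrev ringR (p : ℕ) : Subalgebra (ZMod p) (MvPowerSeries (Fin 2) (ZMod p)) :=
  powerSeriesSubalgebra (ZMod p) monoidR

/-- `F_p[[X^5, X^4 Y, X^3 Y^2, X^2 Y^3, X Y^4, Y^5]]`. -/
noncomputable abbrev ringS (p : ℕ) : Subalgebra (ZMod p) (MvPowerSeries (Fin 2) (ZMod p)) :=
  powerSeriesSubalgebra (ZMod p) monoidS

lemma ringR_le_ringS (p : ℕ) : ringR p ≤ ringS p := by
  have h : monoidR ≤ monoidS := AddSubmonoid.closure_mono (by
    rintro x (rfl | rfl | rfl | rfl) <;> simp)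
  exact fun f hf n hn => h (hf n hn)

/-- `S` is an algebra over `R` through the inclusion. -/
noncomputable instance (p : ℕ) : Algebra (ringR p) (ringS p) :=
  (Subalgebra.inclusion (ringR_le_ringS p)).toRingHom.toAlgebra

section Instances

variable {k : Type*} [Field k] {σ : Type*} (H : AddSubmonoid (σ →₀ ℕ))

lemma inv_mem {f : MvPowerSeries σ k} (hf : f ∈ powerSeriesSubalgebra k H) :
    f⁻¹ ∈ powerSeriesSubalgebra k H := by
  classical
  intro n
  induction n using WellFoundedLT.induction with
  | ind n ih =>
    intro hn
    rw [coeff_inv] at hn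
    split_ifs at hn with h0
    · exact h0 ▸ H.zero_mem
    · obtain ⟨⟨a, b⟩, hab, h⟩ := Finset.exists_ne_zero_of_sum_ne_zero (right_ne_zero_of_mul hn)
      simp only at h
      split_ifs at h with hlt
      · rw [← Finset.HasAntidiagonal.mem_antidiagonal.1 hab]
        exact H.add_mem (hf a (left_ne_zero_of_mul h)) (ih b hlt (right_ne_zero_of_mul h))
      · exact absurd rfl h

instance : IsLocalRing (powerSeriesSubalgebra k H) := by
  have : IsLocalHom (powerSeriesSubalgebra k H).val.toRingHom := by
    refine ⟨fun f hf => ?_⟩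
    have h0 : constantCoeff (f : MvPowerSeries σ k) ≠ 0 := (hf.map constantCoeff).ne_zero
    exact IsUnit.of_mul_eq_one ⟨_, inv_mem H f.2⟩ (Subtype.ext (MvPowerSeries.mul_inv_cancel _ h0))
  exact RingHom.domain_isLocalRing (powerSeriesSubalgebra k H).val.toRingHom

instance (p : ℕ) [Fact p.Prime] (H : AddSubmonoid (σ →₀ ℕ)) :
    CharP (powerSeriesSubalgebra (ZMod p) H) p :=
  charP_of_injective_algebraMap (algebraMap (ZMod p) _).injective p

end Instances

/-- The monomial `X ^ a * Y ^ b` as an element of `R`. -/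
noncomputable def monoR (p a b : ℕ) (h : expo a b ∈ monoidR) : ringR p :=
  ⟨X 0 ^ a * X 1 ^ b, by
    classical
    intro n hn
    rw [X_pow_eq, X_pow_eq, monomial_mul_monomial, coeff_monomial] at hn
    by_cases h' : n = Finsupp.single 0 a + Finsupp.single 1 b
    · exact h' ▸ h
    · simp [h'] at hn⟩

lemma gen_mem {n : Fin 2 →₀ ℕ}
    (h : n = expo 5 0 ∨ n = expo 4 1 ∨ n = expo 1 4 ∨ n = expo 0 5) : n ∈ monoidR :=
  AddSubmonoid.subset_closure h

/-- The element `X^5` of `R`. -/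
noncomputable def x5 (p : ℕ) : ringR p := monoR p 5 0 (gen_mem (by simp))

/-- The element `X^4 Y` of `R`. -/
noncomputable def x4y (p : ℕ) : ringR p := monoR p 4 1 (gen_mem (by simp))

/-- The element `X Y^4` of `R`. -/
noncomputable def xy4 (p : ℕ) : ringR p := monoR p 1 4 (gen_mem (by simp))

/-- The element `Y^5` of `R`. -/
noncomputable def y5 (p : ℕ) : ringR p := monoR p 0 5 (gen_mem (by simp))

/-- The ideal `Q = (X^5, Y^5)` of `R`. -/
noncomputable def idealQ (p : ℕ) : Ideal (ringR p) := Ideal.span {x5 p, y5 p}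

end TightHilbert

open TightHilbert

/-! Both rings consist of the power series whose exponents lie in a monoid. The monoid of `S` is
given by `5 ∣ a + b`, and the monoid of `R` omits only the four exponents (3,2), (2,3), (3,7), (7,3)
from it (`mem_monoidR_iff`). Hence `S / R` has length 4, and every length of a quotient by a
monomial ideal is a number of exponents (`length_quotient_supportedOn`).

Tight closure: minimal exponents and high Frobenius powers show that exponents of elements in the
closure of a monomial ideal are divisible, among all monomials, by a generator
(`exists_le_of_mem_tightClosure`); conversely a monomial multiplier carries `S` into `R`
(`mem_tightClosure_of_exists`). So `(Q^n)^*` consists of the exponents `m` in the monoid of `R` with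
`n ≤ ⌊m₀/5⌋ + ⌊m₁/5⌋`. Counting gives `5 * (n + 1).choose 2 - 4` for `n ≥ 2` and 3 for `n = 1`,
whereas `ℓ(R/Q^n) = 5 * (n + 1).choose 2 + 2 * n`. Thus `e_0 = 5`, `e_1 = -2`, `e_1^* = 0`, and
`ℓ(R/Q) = 7 ≠ 3 = ℓ(R/Q^*)` excludes F-rationality. Comparing `ℓ(R/Q) - e_0 = 7 - 5` with `24 - 20`
for `(X^10, Y^10)` excludes the Buchsbaum property.

Every system of parameters of `R` is regular on `S` (`regular_of_radical_eq`). This gives `(S_2)`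
for `S`, and also `ℓ(S/QS) ≤ e_0(Q)`; together with `ℓ(R/Q) ≤ ℓ(S/QS) + 4` it bounds `ℓ(R/Q) -
e_0(Q)` by 4. Finally `X^7 Y^3` is outside `R` but is carried into `R` by the maximal ideal, so `R`
has no regular sequence of length two. -/

namespace TightHilbert

open MvPowerSeries
open scoped Pointwise

/-! ### Power series supported on a set of exponents -/

/-! ### Lengths: extending a submodule by one simple factor. -/

section Abstract

variable {R : Type*} [CommRing R] [IsLocalRing R]

/-- If `P'` is generated over `P` by one element whose annihilator modulo `P` is the maximal ideal,
then passing from `P'` to `P` increases the length of the quotient by one. -/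
lemma length_quotient_eq_add_one {N : Type*} [AddCommGroup N] [Module R N] {P P' : Submodule R N}
    (hPP' : P ≤ P') {x : N} (hx : x ∈ P')
    (hcoef : ∀ r : R, r • x ∈ P ↔ r ∈ IsLocalRing.maximalIdeal R)
    (hgen : ∀ y ∈ P', ∃ c : R, y - c • x ∈ P) :
    Module.length R (N ⧸ P) = Module.length R (N ⧸ P') + 1 := by
  let f : (R ⧸ IsLocalRing.maximalIdeal R) →ₗ[R] N ⧸ P :=
    Submodule.liftQ _ (P.mkQ ∘ₗ LinearMap.toSpanSingleton _ N x) (by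
      intro r hr
      simp only [LinearMap.mem_ker, LinearMap.comp_apply, LinearMap.toSpanSingleton_apply,
        Submodule.mkQ_apply, Submodule.Quotient.mk_eq_zero]
      exact (hcoef r).2 hr)
  have hfmk : ∀ r : R, f (Submodule.Quotient.mk r) = Submodule.Quotient.mk (r • x) := fun r => rfl
  have hf : Function.Injective f := by
    rw [← LinearMap.ker_eq_bot]
    apply Submodule.ker_liftQ_eq_bot
    intro r hr
    simp only [LinearMap.mem_ker, LinearMap.comp_apply, LinearMap.toSpanSingleton_apply,
        Submodule.mkQ_apply, Submodule.Quotient.mk_eq_zero] at hr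
    exact (hcoef r).1 hr
  have hex : Function.Exact f (Submodule.factor hPP') := by
    intro y
    induction y using Submodule.Quotient.induction_on with
    | _ y =>
    have : Submodule.factor hPP' (Submodule.Quotient.mk y) = Submodule.Quotient.mk y := rfl
    rw [this, Submodule.Quotient.mk_eq_zero]
    constructor
    · intro hy
      obtain ⟨c, hc⟩ := hgen y hy
      refine ⟨Submodule.Quotient.mk c, ?_⟩
      rw [hfmk, eq_comm, Submodule.Quotient.eq]
      exact hc
    · rintro ⟨r, hr⟩
      induction r using Submodule.Quotient.induction_on with
      | _ r =>
      rw [hfmk, eq_comm, Submodule.Quotient.eq] at hr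
      simpa using add_mem (hPP' hr) (P'.smul_mem r hx)
  have hs : IsSimpleModule R (R ⧸ IsLocalRing.maximalIdeal R) :=
    isSimpleModule_iff_isCoatom.2 (Ideal.isMaximal_def.1 inferInstance)
  rw [Module.length_eq_add_of_exact f (Submodule.factor hPP') hf
    (Submodule.factor_surjective hPP') hex, Module.length_eq_one, add_comm]

end Abstract

/-- The algebra structure identifies `R` with the ring `k[[H]]` of power series with exponents
in `H`. -/
class IsMonoidSeries (k : Type*) [CommRing k] {σ : Type*} (H : AddSubmonoid (σ →₀ ℕ))
    (R : Type*) [CommRing R] [Algebra R (MvPowerSeries σ k)] : Prop where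
  injective : Function.Injective (algebraMap R (MvPowerSeries σ k))
  range_eq : Set.range (algebraMap R (MvPowerSeries σ k)) = {f | ∀ n, coeff n f ≠ 0 → n ∈ H}

section Supported

variable {k : Type*} [Field k] {σ : Type*} {H : AddSubmonoid (σ →₀ ℕ)}

lemma exists_add_eq_of_coeff_mul_ne_zero {f g : MvPowerSeries σ k} {n : σ →₀ ℕ}
    (h : coeff n (f * g) ≠ 0) : ∃ a b, a + b = n ∧ coeff a f ≠ 0 ∧ coeff b g ≠ 0 := by
  classical
  rw [coeff_mul] at h
  obtain ⟨⟨a, b⟩, hab, h⟩ := Finset.exists_ne_zero_of_sum_ne_zero h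
  exact ⟨a, b, Finset.HasAntidiagonal.mem_antidiagonal.1 hab, left_ne_zero_of_mul h,
    right_ne_zero_of_mul h⟩

lemma eq_of_coeff_monomial_ne_zero {m n : σ →₀ ℕ} {c : k} (h : coeff m (monomial n c) ≠ 0) :
    m = n := by
  classical
  by_contra e
  rw [coeff_monomial, if_neg e] at h
  exact h rfl

variable {R : Type*} [CommRing R] [Algebra R (MvPowerSeries σ k)]

namespace IsMonoidSeries

variable (k H) in
lemma mem_of_coeff_ne_zero [IsMonoidSeries k H R] (f : R) {n : σ →₀ ℕ}
    (hn : coeff n (algebraMap R (MvPowerSeries σ k) f) ≠ 0) : n ∈ H := by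
  have : algebraMap R (MvPowerSeries σ k) f ∈ {f | ∀ n, coeff n f ≠ 0 → n ∈ H} := by
    rw [← range_eq (k := k) (H := H) (R := R)]
    exact ⟨f, rfl⟩
  exact this n hn

variable (H R) in
lemma exists_eq [IsMonoidSeries k H R] {f : MvPowerSeries σ k} (hf : ∀ n, coeff n f ≠ 0 → n ∈ H) :
    ∃ r : R, algebraMap R (MvPowerSeries σ k) r = f := by
  have : f ∈ Set.range (algebraMap R (MvPowerSeries σ k)) := by
    rw [range_eq (k := k) (H := H) (R := R)]
    exact hf
  exact this

variable (k H R) in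
lemma exists_monomial [IsMonoidSeries k H R] (h : H) (c : k) :
    ∃ r : R, algebraMap R (MvPowerSeries σ k) r = monomial (h : σ →₀ ℕ) c :=
  exists_eq H R fun _ hn => eq_of_coeff_monomial_ne_zero hn ▸ h.2

variable (k H R) in
/-- The monomial with exponent `h ∈ H` as an element of `R = k[[H]]`. -/
noncomputable def mono [IsMonoidSeries k H R] (h : H) : R := (exists_monomial k H R h 1).choose

section

variable [IsMonoidSeries k H R]

@[simp]
lemma map_mono (h : H) :
    algebraMap R (MvPowerSeries σ k) (mono k H R h) = monomial (h : σ →₀ ℕ) 1 :=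
  (exists_monomial k H R h 1).choose_spec

lemma mono_add (a b : H) : mono k H R (a + b) = mono k H R a * mono k H R b :=
  injective (k := k) (H := H) (by simp [monomial_mul_monomial])

lemma mono_zero : mono k H R 0 = 1 := injective (k := k) (H := H) (by simp)

lemma mono_pow (a : H) (n : ℕ) : mono k H R a ^ n = mono k H R (n • a) := by
  induction n with
  | zero => simp [mono_zero]
  | succ n ih => rw [pow_succ, ih, succ_nsmul, mono_add]

end

lemma isDomain (_ : IsMonoidSeries k H R) : IsDomain R :=
  have : IsDomain (MvPowerSeries σ k) := NoZeroDivisors.to_isDomain _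
  (injective (k := k) (H := H) (R := R)).isDomain (algebraMap R (MvPowerSeries σ k))

/-- The inverse of a power series supported on `H` is again supported on `H` (`inv_mem`), so units
are detected in the full power series ring. -/
lemma isUnit_iff (_ : IsMonoidSeries k H R) {f : R} :
    IsUnit f ↔ coeff 0 (algebraMap R (MvPowerSeries σ k) f) ≠ 0 := by
  rw [coeff_zero_eq_constantCoeff_apply]
  constructor
  · intro h
    exact ((h.map (algebraMap R (MvPowerSeries σ k))).map constantCoeff).ne_zero
  · intro h0
    have h1 : algebraMap R (MvPowerSeries σ k) f ∈ powerSeriesSubalgebra k H :=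
      fun n hn => mem_of_coeff_ne_zero k H f hn
    obtain ⟨g, hg⟩ := exists_eq H R (inv_mem H h1)
    refine IsUnit.of_mul_eq_one g (injective (k := k) (H := H) ?_)
    rw [map_mul, hg, MvPowerSeries.mul_inv_cancel _ h0, map_one]

lemma isLocalRing (hR : IsMonoidSeries k H R) : IsLocalRing R := by
  have := hR.isDomain
  refine IsLocalRing.of_nonunits_add fun a b ha hb => ?_
  rw [mem_nonunits_iff, hR.isUnit_iff, not_not] at *
  rw [map_add, map_add, ha, hb, add_zero]

lemma mem_maximalIdeal_iff (hR : IsMonoidSeries k H R) [IsLocalRing R] {f : R} :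
    f ∈ IsLocalRing.maximalIdeal R ↔ coeff 0 (algebraMap R (MvPowerSeries σ k) f) = 0 := by
  rw [IsLocalRing.mem_maximalIdeal, mem_nonunits_iff, hR.isUnit_iff, not_not]

end IsMonoidSeries

open IsMonoidSeries

section

variable [IsMonoidSeries k H R]

variable (k H R) in
/-- The `R`-submodule of all power series supported on a set of exponents that is stable under
addition of elements of `H`, where `R = k[[H]]`. -/
def supportedOn {A : Set (σ →₀ ℕ)} (hA : ∀ h ∈ H, ∀ a ∈ A, h + a ∈ A) :
    Submodule R (MvPowerSeries σ k) where
  carrier := {f | ∀ n, coeff n f ≠ 0 → n ∈ A}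
  zero_mem' := fun n hn => absurd (by simp) hn
  add_mem' := by
    intro f g hf hg n hn
    by_cases h : coeff n f = 0
    · exact hg n (by simpa [h] using hn)
    · exact hf n h
  smul_mem' := by
    intro r f hf n hn
    rw [Algebra.smul_def] at hn
    obtain ⟨a, b, rfl, ha, hb⟩ := exists_add_eq_of_coeff_mul_ne_zero hn
    exact hA a (mem_of_coeff_ne_zero k H r ha) b (hf b hb)

lemma mem_supportedOn {A : Set (σ →₀ ℕ)} {hA : ∀ h ∈ H, ∀ a ∈ A, h + a ∈ A}
    {f : MvPowerSeries σ k} : f ∈ supportedOn k H R hA ↔ ∀ n, coeff n f ≠ 0 → n ∈ A := Iff.rfl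

lemma add_mem_add_submonoid (F : Set (σ →₀ ℕ)) :
    ∀ h ∈ H, ∀ a ∈ F + (H : Set (σ →₀ ℕ)), h + a ∈ F + (H : Set (σ →₀ ℕ)) := by
  rintro h hh _ ⟨f, hf, g, hg, rfl⟩
  exact ⟨f, hf, h + g, H.add_mem hh hg, by simp only; abel⟩

variable (H R) in
-- Division by one monomial: `g` collects the coefficients of `f` on the translate `a + H`, so the
-- difference keeps exactly the part of `f` off that translate. Repeating this for finitely many
-- monomials proves `span_monomial_eq_supportedOn`.
lemma exists_coeff_sub_monomial_mul (f : MvPowerSeries σ k) (a : σ →₀ ℕ) :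
    ∃ g : R, ∀ n, coeff n (f - g • monomial a 1) ≠ 0 →
      coeff n f ≠ 0 ∧ ∀ h ∈ H, n ≠ a + h := by
  classical
  let g : MvPowerSeries σ k := fun h => if h ∈ H then coeff (a + h) f else 0
  have hg : ∀ h, coeff h g = if h ∈ H then coeff (a + h) f else 0 := fun h => rfl
  obtain ⟨r, hr⟩ := exists_eq H R (f := g) (fun n hn => by
    by_contra h
    simp [hg, h] at hn)
  refine ⟨r, fun n hn => ?_⟩
  rw [map_sub, Algebra.smul_def, hr, mul_comm, coeff_monomial_mul] at hn
  simp only [hg, one_mul] at hn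
  split_ifs at hn with h1 h2
  · rw [add_tsub_cancel_of_le h1, sub_self] at hn
    exact absurd rfl hn
  · refine ⟨by simpa using hn, ?_⟩
    rintro h hh rfl
    simp [hh] at h2
  · refine ⟨by simpa using hn, ?_⟩
    rintro h hh rfl
    simp at h1

variable (k H R) in
/-- The `k[[H]]`-module generated by finitely many monomials consists of all power series supported
on the translates of `H` by their exponents. -/
lemma span_monomial_eq_supportedOn {F : Set (σ →₀ ℕ)} (hF : F.Finite) :
    Submodule.span R ((fun h => monomial h (1 : k)) '' F) =
      supportedOn k H R (add_mem_add_submonoid (H := H) F) := by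
  classical
  apply le_antisymm
  · rw [Submodule.span_le]
    rintro _ ⟨h, hh, rfl⟩ n hn
    exact eq_of_coeff_monomial_ne_zero hn ▸ ⟨h, hh, 0, H.zero_mem, by simp⟩
  · induction F, hF using Set.Finite.induction_on with
    | empty =>
      intro f hf
      have : f = 0 := by
        ext n
        by_contra h
        have := hf n h
        simp at this
      rw [this]; exact zero_mem _
    | @insert a F _ _ ih =>
      intro f hf
      obtain ⟨g, hg⟩ := exists_coeff_sub_monomial_mul H R f a
      have h1 : f - g • monomial a 1 ∈ supportedOn k H R (add_mem_add_submonoid (H := H) F) := by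
        intro n hn
        obtain ⟨h1, h2⟩ := hg n hn
        obtain ⟨b, hb, c, hc, rfl⟩ := hf n h1
        rcases hb with rfl | hb
        · exact absurd rfl (h2 c hc)
        · exact ⟨b, hb, c, hc, rfl⟩
      have h2 := Submodule.span_mono (Set.image_mono (Set.subset_insert a F)) (ih h1)
      have h3 : g • monomial a 1 ∈ Submodule.span R
          ((fun h => monomial h (1 : k)) '' insert a F) :=
        Submodule.smul_mem _ g (Submodule.subset_span ⟨a, Set.mem_insert _ _, rfl⟩)
      simpa using add_mem h2 h3

variable (k R) in
/-- The ideal of `R = k[[H]]` generated by the monomials with exponents in `F ⊆ H`. -/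
noncomputable def monoIdeal (F : Set H) : Ideal R := Ideal.span (mono k H R '' F)

/-- The image of the ideal in the power series ring is the `R`-span of its monomial generators, so
`span_monomial_eq_supportedOn` reduces membership to a condition on each exponent. -/
lemma mem_monoIdeal {F : Set H} (hF : F.Finite) {f : R} :
    f ∈ monoIdeal k R F ↔ ∀ n, coeff n (algebraMap R (MvPowerSeries σ k) f) ≠ 0 →
      ∃ a ∈ F, ∃ h ∈ H, a + h = n := by
  have e : Submodule.map (Algebra.linearMap R (MvPowerSeries σ k)) (monoIdeal k R F) =
      supportedOn k H R (add_mem_add_submonoid (H := H) (((↑) : H → σ →₀ ℕ) '' F)) := by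
    rw [← span_monomial_eq_supportedOn k H R (hF.image _), monoIdeal, Ideal.span,
      Submodule.map_span, ← Set.image_comp, ← Set.image_comp]
    congr 1
    refine Set.image_congr fun h _ => ?_
    simp
  have h1 : f ∈ monoIdeal k R F ↔ algebraMap R (MvPowerSeries σ k) f ∈
      Submodule.map (Algebra.linearMap R (MvPowerSeries σ k)) (monoIdeal k R F) := by
    constructor
    · exact fun h => ⟨f, h, rfl⟩
    · rintro ⟨g, hg, h⟩
      exact (injective (k := k) (H := H) h : g = f) ▸ hg
  rw [h1, e, mem_supportedOn]
  refine forall₂_congr fun n _ => ?_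
  constructor
  · rintro ⟨_, ⟨a, ha, rfl⟩, h, hh, rfl⟩
    exact ⟨a, ha, h, hh, rfl⟩
  · rintro ⟨a, ha, h, hh, rfl⟩
    exact ⟨_, ⟨a, ha, rfl⟩, h, hh, rfl⟩

lemma monoIdeal_mul (F G : Set H) : monoIdeal k R F * monoIdeal k R G = monoIdeal k R (F + G) := by
  rw [monoIdeal, monoIdeal, Ideal.span_mul_span', monoIdeal]
  congr 1
  ext x
  constructor
  · rintro ⟨_, ⟨a, ha, rfl⟩, _, ⟨b, hb, rfl⟩, rfl⟩
    exact ⟨a + b, ⟨a, ha, b, hb, rfl⟩, mono_add a b⟩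
  · rintro ⟨_, ⟨a, ha, b, hb, rfl⟩, rfl⟩
    exact ⟨_, ⟨a, ha, rfl⟩, _, ⟨b, hb, rfl⟩, (mono_add a b).symm⟩

lemma monoIdeal_pow (F : Set H) (n : ℕ) : monoIdeal k R F ^ n = monoIdeal k R (n • F) := by
  induction n with
  | zero => simp [monoIdeal, mono_zero, Ideal.one_eq_top]
  | succ n ih => rw [pow_succ, ih, monoIdeal_mul, succ_nsmul]

/-- The length of a quotient of monomial modules is the number of monomials in the difference. -/
lemma length_quotient_supportedOn [IsLocalRing R] {N : Type*} [AddCommGroup N] [Module R N]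
    (φ : N →ₗ[R] MvPowerSeries σ k) {B : Set (σ →₀ ℕ)}
    (hB : ∀ h ∈ H, ∀ b ∈ B, h + b ∈ B) (hφ : LinearMap.range φ = supportedOn k H R hB)
    {A : Set (σ →₀ ℕ)} (hA : ∀ h ∈ H, ∀ a ∈ A, h + a ∈ A) (hAB : A ⊆ B) (n : ℕ)
    (hn : (B \ A).encard = n) :
    Module.length R (N ⧸ (supportedOn k H R hA).comap φ) = n := by
  classical
  induction n generalizing A with
  | zero =>
    have h1 : B ⊆ A := by
      simpa [Set.sdiff_eq_empty] using hn
    have h2 : (supportedOn k H R hA).comap φ = ⊤ := by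
      rw [eq_top_iff]
      intro x _
      have : φ x ∈ supportedOn k H R hB := hφ ▸ LinearMap.mem_range_self φ x
      exact fun m hm => h1 (this m hm)
    rw [h2, Nat.cast_zero, Module.length_eq_zero_iff]
    exact Submodule.Quotient.subsingleton_iff.2 rfl
  | succ n ih =>
    have hfin : (B \ A).Finite := Set.finite_of_encard_eq_coe hn
    have hne : (B \ A).Nonempty := by
      rw [← Set.encard_ne_zero, hn]
      exact Nat.cast_ne_zero.2 n.succ_ne_zero
    -- A maximal `b` in `B \ A` can be added to `A` without losing stability under `H`: for `h ≠ 0`,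
    -- `h + b` lies in `B` strictly above `b`, hence in `A`. The enlarged module exceeds the old one
    -- by a single factor `k`.
    obtain ⟨b, hb⟩ := hfin.exists_maximal hne
    have hbA : b ∉ A := hb.1.2
    have hA' : ∀ h ∈ H, ∀ a ∈ insert b A, h + a ∈ insert b A := by
      rintro h hh a (rfl | ha)
      · by_cases h0 : h = 0
        · simp [h0]
        · right
          by_contra hc
          have h1 := hb.2 (⟨hB h hh a hb.1.1, hc⟩ : h + a ∈ B \ A) le_add_self
          have : h ≤ 0 := by simpa using h1
          exact h0 (le_antisymm this (zero_le (a := h)))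
      · exact Or.inr (hA h hh a ha)
    have hcard : (B \ insert b A).encard = n := by
      have h1 : B \ A = insert b (B \ insert b A) := by
        ext x
        by_cases e : x = b
        · subst e; simp [hb.1.1, hbA]
        · simp [e]
      rw [h1, Set.encard_insert_of_notMem (by simp)] at hn
      have h2 : (B \ insert b A).encard + 1 = (n : ℕ∞) + 1 := by simpa using hn
      exact by simpa using h2
    have ih' := ih hA' (Set.insert_subset hb.1.1 hAB) hcard
    obtain ⟨x, hx⟩ : monomial b (1 : k) ∈ LinearMap.range φ := by
      rw [hφ]
      intro m hm
      exact eq_of_coeff_monomial_ne_zero hm ▸ hb.1.1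
    have hle : (supportedOn k H R hA).comap φ ≤ (supportedOn k H R hA').comap φ :=
      fun y hy m hm => Or.inr (hy m hm)
    rw [length_quotient_eq_add_one hle (x := x), ih', Nat.cast_succ]
    · intro m hm
      rw [hx] at hm
      exact Or.inl (eq_of_coeff_monomial_ne_zero hm)
    · intro r
      have hφr : φ (r • x) = algebraMap R (MvPowerSeries σ k) r * monomial b 1 := by
        rw [map_smul, hx, Algebra.smul_def]
      rw [mem_maximalIdeal_iff (k := k) (H := H) inferInstance]
      constructor
      · intro h
        by_contra hc
        refine hbA (h b ?_)
        rw [hφr]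
        simpa [coeff_mul_monomial] using hc
      · intro h m hm
        rw [hφr] at hm
        obtain ⟨c, d, rfl, hc, hd⟩ := exists_add_eq_of_coeff_mul_ne_zero hm
        obtain rfl := eq_of_coeff_monomial_ne_zero hd
        have hc0 : c ≠ 0 := by rintro rfl; exact hc h
        rcases hA' c (mem_of_coeff_ne_zero k H r hc) d (Set.mem_insert _ _) with h1 | h1
        · exact absurd (by simpa using h1) hc0
        · exact h1
    · intro y hy
      -- The constant equal to the coefficient of `φ y` at `b`: subtracting this multiple of the
      -- monomial removes the only exponent outside `A`.
      obtain ⟨c, hc⟩ := exists_monomial k H R 0 (coeff b (φ y))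
      refine ⟨c, fun m hm => ?_⟩
      have h1 : φ (y - c • x) = φ y - monomial b (coeff b (φ y)) := by
        rw [map_sub, map_smul, hx, Algebra.smul_def, hc, monomial_mul_monomial]
        simp
      rw [h1, map_sub, coeff_monomial] at hm
      by_cases e : m = b
      · subst e; simp at hm
      · rcases hy m (by simpa [e] using hm) with h2 | h2
        · exact absurd h2 e
        · exact h2

variable (k H R) in
/-- The length of the quotient of `k[[H]]` by an ideal defined by a set of exponents. -/
lemma length_quotient_ideal [IsLocalRing R] {A : Set (σ →₀ ℕ)}
    (hA : ∀ h ∈ H, ∀ a ∈ A, h + a ∈ A) (hAH : A ⊆ H) {I : Ideal R}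
    (hI : ∀ f : R, f ∈ I ↔ ∀ n, coeff n (algebraMap R (MvPowerSeries σ k) f) ≠ 0 → n ∈ A)
    {n : ℕ} (hn : ((H : Set (σ →₀ ℕ)) \ A).encard = n) :
    Module.length R (R ⧸ I) = n := by
  have h1 : I = (supportedOn k H R hA).comap (Algebra.linearMap R (MvPowerSeries σ k)) := by
    ext f
    exact hI f
  rw [h1]
  refine length_quotient_supportedOn _ (fun h hh b hb => H.add_mem hh hb) ?_ hA hAH n hn
  ext f
  constructor
  · rintro ⟨g, rfl⟩
    exact fun n hn => mem_of_coeff_ne_zero k H g hn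
  · intro hf
    exact exists_eq H R hf

variable (k H R) in
/-- If `H` is covered by finitely many translates of a submonoid `G`, then `k[[H]]` is finite over
`k[[G]]`. -/
lemma finite_of_add_eq {G : AddSubmonoid (σ →₀ ℕ)} {A : Type*} [CommRing A]
    [Algebra A (MvPowerSeries σ k)] [IsMonoidSeries k G A] [Algebra A R]
    [IsScalarTower A R (MvPowerSeries σ k)]
    {F : Set (σ →₀ ℕ)} (hF : F.Finite) (hFG : F + (G : Set (σ →₀ ℕ)) = H) :
    Module.Finite A R := by
  let φ : R →ₗ[A] MvPowerSeries σ k := (IsScalarTower.toAlgHom A R (MvPowerSeries σ k)).toLinearMap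
  refine ⟨Submodule.fg_of_fg_map_injective φ (injective (k := k) (H := H)) ?_⟩
  have : Submodule.map φ ⊤ = Submodule.span A ((fun h => monomial h (1 : k)) '' F) := by
    rw [span_monomial_eq_supportedOn k G A hF]
    ext f
    rw [mem_supportedOn, hFG]
    constructor
    · rintro ⟨g, -, rfl⟩
      exact fun n hn => mem_of_coeff_ne_zero k H g hn
    · intro hf
      obtain ⟨r, hr⟩ := exists_eq H R hf
      exact ⟨r, trivial, hr⟩
  rw [this]
  exact Submodule.fg_span (hF.image _)

end

/-- The ring `k[[H]]` defined as a subalgebra. -/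
instance (H : AddSubmonoid (σ →₀ ℕ)) : IsMonoidSeries k H (powerSeriesSubalgebra k H) where
  injective := Subtype.val_injective
  range_eq := by
    ext f
    constructor
    · rintro ⟨g, rfl⟩
      exact g.2
    · intro hf
      exact ⟨⟨f, hf⟩, rfl⟩

/-- If `H` is covered by finitely many translates of `N • (σ →₀ ℕ)`, then `k[[H]]` is
Noetherian. -/
lemma IsMonoidSeries.isNoetherianRing (_ : IsMonoidSeries k H R) [Finite σ] {N : ℕ} (hN : N ≠ 0)
    {F : Set (σ →₀ ℕ)} (hF : F.Finite) (h0 : 0 ∈ F)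
    (hFH : F + (AddMonoidHom.mrange (nsmulAddMonoidHom (α := σ →₀ ℕ) N) : Set (σ →₀ ℕ)) = H) :
    IsNoetherianRing R := by
  set G := AddMonoidHom.mrange (nsmulAddMonoidHom (α := σ →₀ ℕ) N) with hG
  have hmem : ∀ f : MvPowerSeries σ k, expand N hN f ∈ powerSeriesSubalgebra k G := by
    intro f n hn
    obtain ⟨m, -, hm⟩ := support_expand_subset N hN f hn
    exact ⟨m, hm⟩
  -- Substituting `X_i ^ N` for `X_i` maps the Noetherian full power series ring onto `k[[G]]`.
  let e : MvPowerSeries σ k →+* powerSeriesSubalgebra k G :=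
    (expand N hN).toRingHom.codRestrict (powerSeriesSubalgebra k G) hmem
  have he : Function.Surjective e := by
    rintro ⟨f, hf⟩
    let g : MvPowerSeries σ k := fun m => coeff (N • m) f
    refine ⟨g, Subtype.ext ?_⟩
    show expand N hN g = f
    ext n
    by_cases hn : n ∈ G
    · obtain ⟨m, rfl⟩ := hn
      exact coeff_expand_smul N hN _ m
    · have h1 : coeff n f = 0 := by
        by_contra h
        exact hn (hf n h)
      rw [h1]
      by_contra h
      exact hn (hmem _ n h)
  have hGN : IsNoetherianRing (powerSeriesSubalgebra k G) :=
    isNoetherianRing_of_surjective _ _ e he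
  let ψ : R →+* MvPowerSeries σ k := algebraMap R (MvPowerSeries σ k)
  have hψ : Function.Injective ψ := injective (k := k) (H := H)
  -- Because `0 ∈ F`, `G` lies in `H`. The ring `R` is only embedded in the power series, so the
  -- inclusion of `k[[G]]` is first taken into the image of `R` and then pulled back.
  let c : powerSeriesSubalgebra k G →+* ψ.range :=
    (powerSeriesSubalgebra k G).val.toRingHom.codRestrict ψ.range (by
      intro f
      obtain ⟨r, hr⟩ := exists_eq H R (f := (f : MvPowerSeries σ k)) (fun n hn => by
        have : n ∈ (H : Set (σ →₀ ℕ)) := hFH ▸ ⟨0, h0, n, f.2 n hn, by simp⟩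
        exact this)
      exact ⟨r, hr⟩)
  let e' := RingEquiv.ofLeftInverse (f := ψ) (Function.leftInverse_invFun hψ)
  let j : powerSeriesSubalgebra k G →+* R := (e'.symm : ψ.range →+* R).comp c
  have hj : ∀ f, ψ (j f) = f := fun f => congrArg Subtype.val (e'.apply_symm_apply (c f))
  let _ := j.toAlgebra
  have : IsScalarTower (powerSeriesSubalgebra k G) R (MvPowerSeries σ k) :=
    IsScalarTower.of_algebraMap_eq fun f => (hj f).symm
  have : Module.Finite (powerSeriesSubalgebra k G) R := finite_of_add_eq k H R (G := G) hF hFH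
  exact IsNoetherianRing.of_finite (powerSeriesSubalgebra k G) R

end Supported

open IsMonoidSeries

/-! ### Maximal ideal, completeness and dimension of `k[[H]]` -/

section Ring

variable {k : Type*} [Field k] {σ : Type*} {H : AddSubmonoid (σ →₀ ℕ)}
  {R : Type*} [CommRing R] [Algebra R (MvPowerSeries σ k)] [IsMonoidSeries k H R]

lemma finite_nsmul {M : Type*} [AddMonoid M] {F : Set M} (hF : F.Finite) (n : ℕ) :
    (n • F).Finite := by
  induction n with
  | zero => simp
  | succ n ih => rw [succ_nsmul]; exact ih.add hF

variable (k R) in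
lemma maximalIdeal_eq_monoIdeal [IsLocalRing R] {F : Set H} (hF : F.Finite) (h0 : 0 ∉ F)
    (hgen : ∀ h ∈ H, h ≠ 0 → ∃ a ∈ F, ∃ b ∈ H, a + b = h) :
    IsLocalRing.maximalIdeal R = monoIdeal k R F := by
  ext f
  rw [mem_maximalIdeal_iff (k := k) (H := H) inferInstance, mem_monoIdeal hF]
  constructor
  · intro hf n hn
    exact hgen n (mem_of_coeff_ne_zero k H f hn) (by rintro rfl; exact hn hf)
  · intro hf
    by_contra hc
    obtain ⟨a, ha, b, -, hab⟩ := hf 0 hc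
    have : (a : σ →₀ ℕ) = 0 := (add_eq_zero.1 hab).1
    exact h0 ((Subtype.ext this : a = 0) ▸ ha)

/-- Each summand is nonzero and has degree at least one. Consequently the `n`-th power of a monomial
ideal has no exponents of degree below `n`, which makes adic limits coefficientwise. -/
lemma le_degree_of_mem_nsmul {F : Set H} (h0 : 0 ∉ F) {n : ℕ} {a : H} (ha : a ∈ n • F) :
    n ≤ Finsupp.degree (a : σ →₀ ℕ) := by
  induction n generalizing a with
  | zero => simp
  | succ n ih =>
    rw [succ_nsmul] at ha
    obtain ⟨b, hb, c, hc, rfl⟩ := ha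
    have h1 := ih hb
    have h2 : Finsupp.degree (c : σ →₀ ℕ) ≠ 0 := by
      rw [Ne, Finsupp.degree_eq_zero_iff]
      intro h
      exact h0 ((Subtype.ext h : c = 0) ▸ hc)
    simp only [AddSubmonoid.coe_add, map_add]
    omega

lemma isAdicComplete_monoIdeal {F : Set H} (hF : F.Finite) (h0 : 0 ∉ F) :
    IsAdicComplete (monoIdeal k R F) R := by
  have hmem : ∀ (n : ℕ) (x : R), x ∈ (monoIdeal k R F ^ n • ⊤ : Submodule R R) ↔
      ∀ m, coeff m (algebraMap R (MvPowerSeries σ k) x) ≠ 0 → ∃ a ∈ n • F, ∃ h ∈ H, a + h = m := by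
    intro n x
    rw [smul_eq_mul, Ideal.mul_top, monoIdeal_pow, mem_monoIdeal (finite_nsmul hF n)]
  have hdeg : ∀ (n : ℕ) (x : R), x ∈ (monoIdeal k R F ^ n • ⊤ : Submodule R R) →
      ∀ m, Finsupp.degree m < n → coeff m (algebraMap R (MvPowerSeries σ k) x) = 0 := by
    intro n x hx m hm
    by_contra hc
    obtain ⟨a, ha, h, -, rfl⟩ := (hmem n x).1 hx m hc
    have := le_degree_of_mem_nsmul h0 ha
    rw [map_add] at hm
    omega
  refine { haus' := fun x hx => ?_, prec' := fun f hf => ?_ }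
  · refine injective (k := k) (H := H) ?_
    rw [map_zero]
    ext m
    have := hx (Finsupp.degree m + 1)
    rw [SModEq.sub_mem, sub_zero] at this
    exact hdeg _ x this m (Nat.lt_succ_self _)
  -- The coefficient at `m` is constant along the Cauchy sequence from index `degree m + 1` on,
  -- since later differences lie in that power of the ideal. It is read off there.
  · let g : MvPowerSeries σ k := fun m =>
      coeff m (algebraMap R (MvPowerSeries σ k) (f (Finsupp.degree m + 1)))
    have hg : ∀ m, coeff m g =
      coeff m (algebraMap R (MvPowerSeries σ k) (f (Finsupp.degree m + 1))) := fun m => rfl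
    obtain ⟨L, hL⟩ := exists_eq H R (f := g) (fun n hn => mem_of_coeff_ne_zero k H _ (hg n ▸ hn))
    refine ⟨L, fun n => ?_⟩
    rw [SModEq.sub_mem, hmem]
    intro m hm
    rw [map_sub, hL, map_sub, hg, ← map_sub, ← map_sub] at hm
    -- If `n` is at most this index, `f n` and the term that defines the limit coefficient differ by
    -- an element of the `n`-th power. Otherwise the coefficient of `f n` at `m` has already
    -- stabilized, so it cannot differ.
    rcases le_total n (Finsupp.degree m + 1) with h | h
    · have := hf h
      rw [SModEq.sub_mem, hmem] at this
      exact this m hm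
    · have := hf h
      rw [SModEq.sub_mem] at this
      have := hdeg _ _ this m (Nat.lt_succ_self _)
      rw [← neg_sub, map_neg, map_neg, this, neg_zero] at hm
      exact absurd rfl hm

end Ring

/-! ### Two variables: parameters given by powers of `X` and `Y`, and dimension two. -/

section TwoVariables

@[simp] lemma expo_apply_zero (a b : ℕ) : expo a b 0 = a := by simp [expo]

@[simp] lemma expo_apply_one (a b : ℕ) : expo a b 1 = b := by simp [expo]

lemma exponent_ext {m n : Fin 2 →₀ ℕ} (h0 : m 0 = n 0) (h1 : m 1 = n 1) : m = n := by
  ext i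
  fin_cases i
  · exact h0
  · exact h1

lemma expo_ne_zero {a b : ℕ} (h : a ≠ 0 ∨ b ≠ 0) : expo a b ≠ 0 := by
  intro h'
  have h0 := DFunLike.congr_fun h' 0
  have h1 := DFunLike.congr_fun h' 1
  simp at h0 h1
  omega

variable {k : Type*} [Field k] {H : AddSubmonoid (Fin 2 →₀ ℕ)}
  {R : Type*} [CommRing R] [Algebra R (MvPowerSeries (Fin 2) k)] [IsMonoidSeries k H R]

lemma mono_pow_eq {N : ℕ} (hx : expo N 0 ∈ H) (hy : expo 0 N ∈ H) (h : H) :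
    mono k H R h ^ N =
      mono k H R ⟨_, hx⟩ ^ (h : Fin 2 →₀ ℕ) 0 * mono k H R ⟨_, hy⟩ ^ (h : Fin 2 →₀ ℕ) 1 := by
  rw [mono_pow, mono_pow, mono_pow, ← mono_add]
  congr 1
  refine Subtype.ext (exponent_ext ?_ ?_) <;> simp [mul_comm]

variable [IsLocalRing R]

lemma mono_mem_maximalIdeal {h : H} (hh : h ≠ 0) : mono k H R h ∈ IsLocalRing.maximalIdeal R := by
  classical
  rw [mem_maximalIdeal_iff (k := k) (H := H) inferInstance, IsMonoidSeries.map_mono, coeff_monomial,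
    if_neg]
  exact fun e => hh (Subtype.ext e.symm)

/-- A prime ideal of `k[[H]]` containing powers of `X` and `Y` is the maximal ideal. -/
lemma eq_maximalIdeal_of_mem {F : Set H} (hm : IsLocalRing.maximalIdeal R = monoIdeal k R F)
    (h0 : 0 ∉ F) {N : ℕ} (hx : expo N 0 ∈ H) (hy : expo 0 N ∈ H) {P : Ideal R} [P.IsPrime]
    (hxP : mono k H R ⟨_, hx⟩ ∈ P) (hyP : mono k H R ⟨_, hy⟩ ∈ P) :
    P = IsLocalRing.maximalIdeal R := by
  refine le_antisymm (IsLocalRing.le_maximalIdeal (Ideal.IsPrime.ne_top ‹_›)) ?_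
  rw [hm, monoIdeal, Ideal.span_le]
  rintro _ ⟨h, hh, rfl⟩
  refine Ideal.IsPrime.mem_of_pow_mem ‹P.IsPrime› N ?_
  rw [mono_pow_eq hx hy]
  by_cases e : (h : Fin 2 →₀ ℕ) 0 = 0
  · have e1 : (h : Fin 2 →₀ ℕ) 1 ≠ 0 := by
      intro e1
      refine h0 ((Subtype.ext (exponent_ext ?_ ?_) : h = 0) ▸ hh)
      · simpa using e
      · simpa using e1
    exact P.mul_mem_left _ (P.pow_mem_of_mem hyP _ (Nat.pos_of_ne_zero e1))
  · exact P.mul_mem_right _ (P.pow_mem_of_mem hxP _ (Nat.pos_of_ne_zero e))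

lemma radical_span_pair_eq {F : Set H} (hm : IsLocalRing.maximalIdeal R = monoIdeal k R F)
    (h0 : 0 ∉ F) {N : ℕ} (hN : N ≠ 0) (hx : expo N 0 ∈ H) (hy : expo 0 N ∈ H) :
    (Ideal.span {mono k H R ⟨_, hx⟩, mono k H R ⟨_, hy⟩}).radical = IsLocalRing.maximalIdeal R := by
  apply le_antisymm
  · rw [(inferInstance : (IsLocalRing.maximalIdeal R).IsPrime).radical_le_iff, Ideal.span_le]
    rintro _ (rfl | rfl)
    · exact mono_mem_maximalIdeal fun e => expo_ne_zero (Or.inl hN) (congrArg Subtype.val e)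
    · exact mono_mem_maximalIdeal fun e => expo_ne_zero (Or.inr hN) (congrArg Subtype.val e)
  · rw [Ideal.radical_eq_sInf]
    refine le_sInf fun P hP => ?_
    have : P.IsPrime := hP.2
    exact (eq_maximalIdeal_of_mem hm h0 hx hy (hP.1 (Ideal.subset_span (by simp)))
      (hP.1 (Ideal.subset_span (by simp)))).ge

variable (k) in
-- Viewed as power series in one variable over the domain of power series in the other variable, the
-- assertion becomes primality of the variable.
lemma prime_X_zero : Prime (X 0 : MvPowerSeries (Fin 2) k) := by
  have : IsDomain (MvPowerSeries (Fin 1) k) := NoZeroDivisors.to_isDomain _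
  rw [← MulEquiv.prime_iff (finSuccEquiv k 1).toRingEquiv.toMulEquiv]
  show Prime (finSuccEquiv k 1 (X 0))
  rw [finSuccEquiv_X_zero]
  exact PowerSeries.X_prime

/-- The dimension of `k[[H]]` is two if `H` contains multiples of both unit vectors. -/
lemma ringKrullDim_eq_two [IsNoetherianRing R] {F : Set H}
    (hm : IsLocalRing.maximalIdeal R = monoIdeal k R F)
    (h0 : 0 ∉ F) {N : ℕ} (hN : N ≠ 0) (hx : expo N 0 ∈ H) (hy : expo 0 N ∈ H) :
    ringKrullDim R = 2 := by
  classical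
  have hdom : IsDomain R := IsMonoidSeries.isDomain (k := k) (H := H) inferInstance
  rw [← IsLocalRing.maximalIdeal_height_eq_ringKrullDim]
  have hxm : mono k H R ⟨_, hx⟩ ∈ IsLocalRing.maximalIdeal R :=
    mono_mem_maximalIdeal fun e => expo_ne_zero (Or.inl hN) (congrArg Subtype.val e)
  have hym : mono k H R ⟨_, hy⟩ ∈ IsLocalRing.maximalIdeal R :=
    mono_mem_maximalIdeal fun e => expo_ne_zero (Or.inr hN) (congrArg Subtype.val e)
  -- Krull's height theorem: the maximal ideal is minimal over two elements.
  have hle : (IsLocalRing.maximalIdeal R).height ≤ 2 := by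
    refine (Ideal.height_le_card_of_mem_minimalPrimes_span (s :=
      {mono k H R ⟨_, hx⟩, mono k H R ⟨_, hy⟩}) (Set.toFinite _) ?_).trans ?_
    · refine ⟨⟨inferInstance, ?_⟩, ?_⟩
      · rw [Ideal.span_le]
        rintro _ (rfl | rfl)
        · exact hxm
        · exact hym
      · rintro P ⟨hP, hle⟩ -
        have : P.IsPrime := hP
        exact (eq_maximalIdeal_of_mem hm h0 hx hy (hle (Ideal.subset_span (by simp)))
          (hle (Ideal.subset_span (by simp)))).ge
    · have := Set.ncard_insert_le (mono k H R ⟨_, hx⟩) {mono k H R ⟨_, hy⟩}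
      rw [Set.ncard_singleton] at this
      exact_mod_cast this
  -- The chain is `0 < (X) ∩ R < 𝔪`: the middle prime contains `X ^ N` but not `Y ^ N`.
  have hge : 2 ≤ (IsLocalRing.maximalIdeal R).height := by
    let I : Ideal (MvPowerSeries (Fin 2) k) := Ideal.span {X 0}
    have hI : I.IsPrime := (Ideal.span_singleton_prime (prime_X_zero k).ne_zero).2 (prime_X_zero k)
    let P : Ideal R := I.comap (algebraMap R (MvPowerSeries (Fin 2) k))
    have hP : P.IsPrime := hI.comap _
    have hPmem : ∀ r : R, r ∈ P ↔ ∀ m : Fin 2 →₀ ℕ, m 0 = 0 →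
        coeff m (algebraMap R (MvPowerSeries (Fin 2) k) r) = 0 := by
      intro r
      rw [← X_dvd_iff, ← Ideal.mem_span_singleton]
      rfl
    have hxP : mono k H R ⟨_, hx⟩ ∈ P := by
      rw [hPmem]
      intro m hm0
      rw [IsMonoidSeries.map_mono, coeff_monomial, if_neg]
      rintro rfl
      exact hN (by simpa using hm0)
    have hyP : mono k H R ⟨_, hy⟩ ∉ P := by
      rw [hPmem]
      intro h
      have := h (expo 0 N) (by simp)
      simp at this
    have h1 : (⊥ : Ideal R) < P := by
      refine bot_lt_iff_ne_bot.2 fun e => ?_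
      rw [e, Ideal.mem_bot] at hxP
      have := congrArg (fun r : R => coeff (expo N 0) (algebraMap R (MvPowerSeries (Fin 2) k) r)) hxP
      simp at this
    have h2 : P < IsLocalRing.maximalIdeal R :=
      lt_of_le_of_ne (IsLocalRing.le_maximalIdeal hP.ne_top) fun e => hyP (e ▸ hym)
    have h3 := Ideal.height_add_one_le_of_lt_of_isPrime h1
    have h4 := Ideal.height_add_one_le_of_lt_of_isPrime h2
    calc (2 : ℕ∞) = 0 + 1 + 1 := by norm_num
      _ ≤ (⊥ : Ideal R).height + 1 + 1 := by gcongr; exact zero_le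
      _ ≤ P.height + 1 := by gcongr
      _ ≤ _ := h4
  rw [le_antisymm hle hge]
  rfl

end TwoVariables

/-! ### The two monoids -/

lemma mem_monoidS_iff {m : Fin 2 →₀ ℕ} : m ∈ monoidS ↔ 5 ∣ m 0 + m 1 := by
  constructor
  · intro h
    induction h using AddSubmonoid.closure_induction with
    | mem x hx => rcases hx with rfl | rfl | rfl | rfl | rfl | rfl <;> simp
    | zero => simp
    | add x y _ _ hx hy => simp only [Finsupp.add_apply]; omega
  · rintro ⟨c, hc⟩
    have hmem : ∀ g ∈ ({expo 5 0, expo 4 1, expo 3 2, expo 2 3, expo 1 4, expo 0 5} :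
        Set (Fin 2 →₀ ℕ)), g ∈ monoidS := fun g hg => AddSubmonoid.subset_closure hg
    -- With `r = m 0 % 5` this is `(0, 0)` for `r = 0` and `(r, 5 - r)` otherwise: `(r + 4) / 5` is
    -- `r / 5` rounded up.
    have hr : expo (m 0 % 5) (5 * ((m 0 % 5 + 4) / 5) - m 0 % 5) ∈ monoidS := by
      have : m 0 % 5 < 5 := Nat.mod_lt _ (by norm_num)
      interval_cases m 0 % 5
      · have : expo 0 0 = 0 := exponent_ext (by simp) (by simp)
        norm_num [this, monoidS.zero_mem]
      all_goals exact hmem _ (by simp)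
    have e : m = (m 0 / 5) • expo 5 0 + ((m 1 / 5) • expo 0 5 +
        expo (m 0 % 5) (5 * ((m 0 % 5 + 4) / 5) - m 0 % 5)) := by
      apply exponent_ext <;> simp <;> omega
    rw [e]
    exact add_mem (nsmul_mem (hmem _ (by simp)) _) (add_mem (nsmul_mem (hmem _ (by simp)) _) hr)

/-- Modulo 5 the first coordinate is determined by the multiplicities of (4,1) and (1,4). Residues
0, 1 and 4 need at most one of these generators. Residue 2 needs 2·(1,4) = (2,8) or 3·(4,1) =
(12,3), and residue 3 needs 2·(4,1) = (8,2) or 3·(1,4) = (3,12); the four excluded exponents are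
those that dominate neither choice. -/
lemma mem_monoidR_iff {m : Fin 2 →₀ ℕ} : m ∈ monoidR ↔ 5 ∣ m 0 + m 1 ∧ ¬ (m 0 = 3 ∧ m 1 = 2) ∧
    ¬ (m 0 = 2 ∧ m 1 = 3) ∧ ¬ (m 0 = 3 ∧ m 1 = 7) ∧ ¬ (m 0 = 7 ∧ m 1 = 3) := by
  constructor
  · intro h
    suffices ∃ a b c d : ℕ, m 0 = 5 * a + 4 * b + c ∧ m 1 = b + 4 * c + 5 * d by
      obtain ⟨a, b, c, d, h0, h1⟩ := this
      refine ⟨⟨a + b + c + d, by omega⟩, ?_, ?_, ?_, ?_⟩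
      all_goals
        rintro ⟨e0, e1⟩
        have hb : b < 4 := by omega
        have hc : c < 4 := by omega
        interval_cases b <;> interval_cases c <;> omega
    induction h using AddSubmonoid.closure_induction with
    | mem x hx =>
      rcases hx with rfl | rfl | rfl | rfl
      · exact ⟨1, 0, 0, 0, by simp⟩
      · exact ⟨0, 1, 0, 0, by simp⟩
      · exact ⟨0, 0, 1, 0, by simp⟩
      · exact ⟨0, 0, 0, 1, by simp⟩
    | zero => exact ⟨0, 0, 0, 0, by simp⟩
    | add x y _ _ hx hy =>
      obtain ⟨a, b, c, d, h0, h1⟩ := hx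
      obtain ⟨a', b', c', d', h0', h1'⟩ := hy
      refine ⟨a + a', b + b', c + c', d + d', ?_, ?_⟩ <;> simp only [Finsupp.add_apply] <;> omega
  · intro h
    have key : ∀ a b c d : ℕ, m 0 = 5 * a + 4 * b + c → m 1 = b + 4 * c + 5 * d → m ∈ monoidR := by
      intro a b c d h0 h1
      have e : m = a • expo 5 0 + b • expo 4 1 + c • expo 1 4 + d • expo 0 5 := by
        apply exponent_ext <;> simp <;> omega
      rw [e]
      refine add_mem (add_mem (add_mem ?_ ?_) ?_) ?_ <;> refine nsmul_mem (gen_mem ?_) _ <;> simp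
    obtain ⟨h, h1, h2, h3, h4⟩ := h
    have : m 0 % 5 < 5 := Nat.mod_lt _ (by norm_num)
    have h5 : m 0 % 5 = 0 ∨ m 0 % 5 = 1 ∨ m 0 % 5 = 2 ∨ m 0 % 5 = 3 ∨ m 0 % 5 = 4 := by omega
    rcases h5 with h5 | h5 | h5 | h5 | h5
    · exact key (m 0 / 5) 0 0 (m 1 / 5) (by omega) (by omega)
    · exact key (m 0 / 5) 0 1 (m 1 / 5) (by omega) (by omega)
    · by_cases h6 : 8 ≤ m 1
      · exact key (m 0 / 5) 0 2 (m 1 / 5 - 1) (by omega) (by omega)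
      · exact key (m 0 / 5 - 2) 3 0 0 (by omega) (by omega)
    · by_cases h6 : 8 ≤ m 0
      · exact key (m 0 / 5 - 1) 2 0 (m 1 / 5) (by omega) (by omega)
      · exact key 0 0 3 (m 1 / 5 - 2) (by omega) (by omega)
    · exact key (m 0 / 5) 1 0 (m 1 / 5) (by omega) (by omega)

lemma monoidR_le_monoidS : monoidR ≤ monoidS := fun _ h =>
  mem_monoidS_iff.2 (mem_monoidR_iff.1 h).1

/-- The exponents of the generators of the maximal ideal of `R`. -/
noncomputable def gensR : Set monoidR :=
  {⟨expo 5 0, gen_mem (by simp)⟩, ⟨expo 4 1, gen_mem (by simp)⟩, ⟨expo 1 4, gen_mem (by simp)⟩,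
    ⟨expo 0 5, gen_mem (by simp)⟩}

lemma mem_gensR {m : monoidR} : m ∈ gensR ↔ ((m : Fin 2 →₀ ℕ) = expo 5 0 ∨
    (m : Fin 2 →₀ ℕ) = expo 4 1 ∨ (m : Fin 2 →₀ ℕ) = expo 1 4 ∨ (m : Fin 2 →₀ ℕ) = expo 0 5) := by
  simp [gensR, Subtype.ext_iff]

lemma gensR_finite : gensR.Finite := by
  unfold gensR; exact Set.toFinite _

lemma zero_notMem_gensR : 0 ∉ gensR := by
  rw [mem_gensR]
  rintro (h | h | h | h) <;> exact expo_ne_zero (by simp) h.symm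

lemma expo_mem_monoidS {a b : ℕ} (h : 5 ∣ a + b) : expo a b ∈ monoidS :=
  mem_monoidS_iff.2 (by simpa using h)

/-- The exponents of a generating set of the maximal ideal of `S`: all of total degree `5`. -/
noncomputable def gensS : Set monoidS := Set.range fun i : Fin 6 =>
  ⟨expo i (5 - i), expo_mem_monoidS (by have := i.2; omega)⟩

/-! ### Maximal ideals, Noetherianity and dimension of the two rings. -/

section Rings

variable {k : Type*} [Field k] {R : Type*} [CommRing R] [Algebra R (MvPowerSeries (Fin 2) k)]

variable (k R) in
lemma maximalIdeal_eq_gensR [IsMonoidSeries k monoidR R] [IsLocalRing R] :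
    IsLocalRing.maximalIdeal R = monoIdeal k R gensR := by
  refine maximalIdeal_eq_monoIdeal k R gensR_finite zero_notMem_gensR ?_
  intro h hh h0
  have h2 : h = 0 ∨ ∃ a ∈ gensR, ∃ b ∈ monoidR, (a : Fin 2 →₀ ℕ) + b = h := by
    induction hh using AddSubmonoid.closure_induction_left with
    | zero => exact Or.inl rfl
    | add_left x hx y hy _ => exact Or.inr ⟨⟨x, gen_mem hx⟩, mem_gensR.2 hx, y, hy, rfl⟩
  exact h2.resolve_left h0

lemma zero_notMem_gensS : 0 ∉ gensS := by
  rintro ⟨i, hi⟩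
  have := congrArg Subtype.val hi
  refine expo_ne_zero ?_ this
  have := i.2
  omega

variable (k R) in
lemma maximalIdeal_eq_gensS [IsMonoidSeries k monoidS R] [IsLocalRing R] :
    IsLocalRing.maximalIdeal R = monoIdeal k R gensS := by
  refine maximalIdeal_eq_monoIdeal k R (Set.finite_range _) zero_notMem_gensS ?_
  intro h hh h0
  have hd := mem_monoidS_iff.1 hh
  have h5 : 5 ≤ h 0 + h 1 := by
    by_contra hlt
    exact h0 (exponent_ext (by simp; omega) (by simp; omega))
  refine ⟨⟨expo (min 5 (h 0)) (5 - min 5 (h 0)), expo_mem_monoidS (by omega)⟩,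
    ⟨⟨min 5 (h 0), by omega⟩, rfl⟩, expo (h 0 - min 5 (h 0)) (h 1 - (5 - min 5 (h 0))),
    expo_mem_monoidS (by omega), ?_⟩
  apply exponent_ext <;> simp <;> omega

/-- The translates of `5 • ℕ²` by one small representative for each residue of the first coordinate
cover the monoid. -/
lemma isNoetherianRing_of_monoidS (h : IsMonoidSeries k monoidS R) : IsNoetherianRing R := by
  refine h.isNoetherianRing (N := 5) (F := {0, expo 4 1, expo 3 2, expo 2 3, expo 1 4})
    (by norm_num) (Set.toFinite _) (by simp) ?_
  ext m
  rw [SetLike.mem_coe, mem_monoidS_iff]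
  constructor
  · rintro ⟨a, ha, _, ⟨c, rfl⟩, rfl⟩
    rcases ha with rfl | rfl | rfl | rfl | rfl <;> simp <;> omega
  · intro hm
    have h5 : m 0 % 5 = 0 ∨ m 0 % 5 = 1 ∨ m 0 % 5 = 2 ∨ m 0 % 5 = 3 ∨ m 0 % 5 = 4 := by omega
    rcases h5 with h5 | h5 | h5 | h5 | h5
    · exact ⟨0, by simp, _, ⟨expo (m 0 / 5) (m 1 / 5), rfl⟩,
        by apply exponent_ext <;> simp <;> omega⟩
    · exact ⟨expo 1 4, by simp, _, ⟨expo (m 0 / 5) (m 1 / 5), rfl⟩,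
        by apply exponent_ext <;> simp <;> omega⟩
    · exact ⟨expo 2 3, by simp, _, ⟨expo (m 0 / 5) (m 1 / 5), rfl⟩,
        by apply exponent_ext <;> simp <;> omega⟩
    · exact ⟨expo 3 2, by simp, _, ⟨expo (m 0 / 5) (m 1 / 5), rfl⟩,
        by apply exponent_ext <;> simp <;> omega⟩
    · exact ⟨expo 4 1, by simp, _, ⟨expo (m 0 / 5) (m 1 / 5), rfl⟩,
        by apply exponent_ext <;> simp <;> omega⟩

/-- Residues 2 and 3 take two translates each, based at (2,8), (12,3) and (8,2), (3,12), whose union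
avoids the missing exponents. -/
lemma isNoetherianRing_of_monoidR (h : IsMonoidSeries k monoidR R) : IsNoetherianRing R := by
  refine h.isNoetherianRing (N := 5)
    (F := {0, expo 4 1, expo 1 4, expo 8 2, expo 3 12, expo 2 8, expo 12 3})
    (by norm_num) (Set.toFinite _) (by simp) ?_
  ext m
  rw [SetLike.mem_coe, mem_monoidR_iff]
  constructor
  · rintro ⟨a, ha, _, ⟨c, rfl⟩, rfl⟩
    rcases ha with rfl | rfl | rfl | rfl | rfl | rfl | rfl <;> simp <;> omega
  · rintro ⟨hm, h1, h2, h3, h4⟩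
    have h5 : m 0 % 5 = 0 ∨ m 0 % 5 = 1 ∨ m 0 % 5 = 2 ∨ m 0 % 5 = 3 ∨ m 0 % 5 = 4 := by omega
    rcases h5 with h5 | h5 | h5 | h5 | h5
    · exact ⟨0, by simp, _, ⟨expo (m 0 / 5) (m 1 / 5), rfl⟩,
        by apply exponent_ext <;> simp <;> omega⟩
    · exact ⟨expo 1 4, by simp, _, ⟨expo (m 0 / 5) (m 1 / 5), rfl⟩,
        by apply exponent_ext <;> simp <;> omega⟩
    · by_cases h6 : 8 ≤ m 1
      · exact ⟨expo 2 8, by simp, _, ⟨expo (m 0 / 5) (m 1 / 5 - 1), rfl⟩,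
          by apply exponent_ext <;> simp <;> omega⟩
      · exact ⟨expo 12 3, by simp, _, ⟨expo (m 0 / 5 - 2) (m 1 / 5), rfl⟩,
          by apply exponent_ext <;> simp <;> omega⟩
    · by_cases h6 : 8 ≤ m 0
      · exact ⟨expo 8 2, by simp, _, ⟨expo (m 0 / 5 - 1) (m 1 / 5), rfl⟩,
          by apply exponent_ext <;> simp <;> omega⟩
      · exact ⟨expo 3 12, by simp, _, ⟨expo (m 0 / 5) (m 1 / 5 - 2), rfl⟩,
          by apply exponent_ext <;> simp <;> omega⟩
    · exact ⟨expo 4 1, by simp, _, ⟨expo (m 0 / 5) (m 1 / 5), rfl⟩,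
        by apply exponent_ext <;> simp <;> omega⟩

lemma ringKrullDim_of_monoidR (h : IsMonoidSeries k monoidR R) : ringKrullDim R = 2 := by
  have := h.isLocalRing
  have := isNoetherianRing_of_monoidR h
  exact ringKrullDim_eq_two (maximalIdeal_eq_gensR k R) zero_notMem_gensR (N := 5) (by norm_num)
    (gen_mem (by simp)) (gen_mem (by simp))

lemma ringKrullDim_of_monoidS (h : IsMonoidSeries k monoidS R) : ringKrullDim R = 2 := by
  have := h.isLocalRing
  have := isNoetherianRing_of_monoidS h
  exact ringKrullDim_eq_two (maximalIdeal_eq_gensS k R) zero_notMem_gensS (N := 5) (by norm_num)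
    (expo_mem_monoidS (by norm_num)) (expo_mem_monoidS (by norm_num))

end Rings

/-! ### Tight closure of monomial ideals -/

section TightClosure

variable {k : Type*} [Field k] {σ : Type*} (p : ℕ) [Fact p.Prime] [CharP k p]

/-- In characteristic `p` the power `f ^ p ^ e` arises by multiplying all exponents by `p ^ e` and
applying the injective Frobenius to the coefficients. Hence its support is exactly `p ^ e` times the
support of `f`. -/
lemma exists_of_coeff_pow_ne_zero {f : MvPowerSeries σ k} {e : ℕ} {n : σ →₀ ℕ}
    (h : coeff n (f ^ p ^ e) ≠ 0) : ∃ m, n = p ^ e • m ∧ coeff m f ≠ 0 := by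
  have hp : p ≠ 0 := (Fact.out : p.Prime).ne_zero
  have : ExpChar k p := ExpChar.prime Fact.out
  rw [← map_iterateFrobenius_expand p hp f e, coeff_map] at h
  have h1 : coeff n (expand (p ^ e) (pow_ne_zero e hp) f) ≠ 0 := fun h0 => h (by rw [h0, map_zero])
  obtain ⟨m, hm, hmn⟩ := support_expand_subset (p ^ e) (pow_ne_zero e hp) f h1
  exact ⟨m, hmn.symm, hm⟩

lemma coeff_smul_pow_ne_zero {f : MvPowerSeries σ k} (e : ℕ) {m : σ →₀ ℕ}
    (h : coeff m f ≠ 0) : coeff (p ^ e • m) (f ^ p ^ e) ≠ 0 := by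
  have hp : p ≠ 0 := (Fact.out : p.Prime).ne_zero
  have : ExpChar k p := ExpChar.prime Fact.out
  rw [← map_iterateFrobenius_expand p hp f e, coeff_map, coeff_expand_smul]
  exact fun h0 => h ((iterateFrobenius k p e).injective (by rw [h0, map_zero]))

variable {H : AddSubmonoid (σ →₀ ℕ)} {R : Type*} [CommRing R] [Algebra R (MvPowerSeries σ k)]
  [IsMonoidSeries k H R] [CharP R p]

/-- Every exponent of an element of the tight closure of a monomial ideal of `k[[H]]` is divisible,
in the ring of all power series, by one of the generators. -/
lemma exists_le_of_mem_tightClosure [Finite σ] {F : Set H} (hF : F.Finite) {f : R}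
    (hf : f ∈ tightClosure p (monoIdeal k R F)) {n : σ →₀ ℕ}
    (hn : coeff n (algebraMap R (MvPowerSeries σ k) f) ≠ 0) : ∃ a ∈ F, (a : σ →₀ ℕ) ≤ n := by
  classical
  have hdom : IsDomain R := IsMonoidSeries.isDomain (k := k) (H := H) inferInstance
  obtain ⟨c, hc, hce⟩ := hf
  have hc0 : c ≠ 0 := fun h => hc ⊥ (by simp [IsDomain.minimalPrimes_eq_singleton_bot]) h
  by_contra hcon
  set φ := algebraMap R (MvPowerSeries σ k) with hφ
  -- The argument takes a minimal exponent `m` that violates the claim and an exponent `u` of the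
  -- multiplier `c`.
  let U : Set (σ →₀ ℕ) := {m | coeff m (φ f) ≠ 0 ∧ ∀ a ∈ F, ¬ (a : σ →₀ ℕ) ≤ m}
  have hU : U.Nonempty := ⟨n, hn, by push Not at hcon; exact hcon⟩
  obtain ⟨m, hmU, hmin⟩ := wellFounded_lt.has_min U hU
  obtain ⟨u, hu⟩ : ∃ u, coeff u (φ c) ≠ 0 := by
    by_contra! h
    refine hc0 (injective (k := k) (H := H) ?_)
    rw [map_zero]
    ext u
    exact h u
  -- For such `e` every coordinate of `u` is below `q = p ^ e`, so adding `u` cannot affect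
  -- divisibility by `q`-th powers.
  obtain ⟨e, he, heu⟩ := (hce.and (Filter.eventually_ge_atTop (Finsupp.degree u))).exists
  set q := p ^ e with hq
  have huq : ∀ i, u i < q := fun i =>
    ((Finsupp.le_degree i u).trans heu).trans_lt (Nat.lt_pow_self (Fact.out : p.Prime).one_lt)
  have hq0 : 0 < q := Nat.pos_of_ne_zero (pow_ne_zero _ (Fact.out : p.Prime).ne_zero)
  have hle : ∀ v : σ →₀ ℕ, q • v ≤ q • m + u → v ≤ m := by
    intro v hv i
    have h1 := hv i
    simp only [Finsupp.add_apply, Finsupp.smul_apply, smul_eq_mul] at h1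
    have h2 : q * v i < q * (m i + 1) := by
      have := huq i
      rw [mul_add]
      omega
    exact Nat.lt_succ_iff.1 (lt_of_mul_lt_mul_left h2 hq0.le)
  -- Nothing cancels: any other contribution uses an exponent `q • v` with `v ≤ m`; such a `v` also
  -- violates the claim, so minimality forces `v = m`.
  have hcoeff : coeff (q • m + u) (φ (c * f ^ q)) ≠ 0 := by
    rw [map_mul, map_pow, coeff_mul, Finset.sum_eq_single (u, q • m)]
    · exact mul_ne_zero hu (coeff_smul_pow_ne_zero p e hmU.1)
    · rintro ⟨a, b⟩ hab hne
      rw [Finset.HasAntidiagonal.mem_antidiagonal] at hab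
      by_contra hc
      obtain ⟨v, rfl, hv⟩ := exists_of_coeff_pow_ne_zero p (right_ne_zero_of_mul hc)
      simp only at hab
      have hvm : v ≤ m := hle v (hab ▸ le_add_self)
      have hvU : v ∈ U := ⟨hv, fun a ha hav => hmU.2 a ha (hav.trans hvm)⟩
      have hvm' : v = m := by
        by_contra hne
        exact hmin v hvU (lt_of_le_of_ne hvm hne)
      subst hvm'
      rw [add_comm] at hab
      exact hne (by rw [add_left_cancel hab])
    · intro h
      exact absurd (Finset.HasAntidiagonal.mem_antidiagonal.2 (add_comm _ _)) h
  -- The Frobenius power is enlarged to the ideal of all power series whose exponents lie above `q •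
  -- F`. Finding `q • m + u` there would make `m` divisible by a generator.
  let J' : Ideal (MvPowerSeries σ k) :=
    { carrier := {g | ∀ n, coeff n g ≠ 0 → ∃ a ∈ F, q • (a : σ →₀ ℕ) ≤ n}
      zero_mem' := fun n hn => absurd (by simp) hn
      add_mem' := by
        intro f g hf hg n hn
        by_cases h : coeff n f = 0
        · exact hg n (by simpa [h] using hn)
        · exact hf n h
      smul_mem' := by
        intro r f hf n hn
        obtain ⟨a, b, rfl, -, hb⟩ := exists_add_eq_of_coeff_mul_ne_zero hn
        obtain ⟨a', ha', h⟩ := hf b hb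
        exact ⟨a', ha', h.trans le_add_self⟩ }
  let J : Ideal R := J'.comap φ
  have hJ : Ideal.span ((fun a : R => a ^ q) '' (monoIdeal k R F : Set R)) ≤ J := by
    rw [Ideal.span_le]
    rintro _ ⟨x, hx, rfl⟩ n hn
    simp only [map_pow] at hn
    obtain ⟨v, rfl, hv⟩ := exists_of_coeff_pow_ne_zero p hn
    obtain ⟨a, ha, h, -, rfl⟩ := (mem_monoIdeal hF).1 hx v hv
    exact ⟨a, ha, nsmul_le_nsmul_right le_self_add q⟩
  obtain ⟨a, ha, h⟩ := hJ he _ hcoeff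
  exact hmU.2 a ha (hle _ h)

/-- An element of `k[[H]]` all of whose exponents lie in translates by `F` of a monoid `G` is in the
tight closure of the ideal generated by `F`, provided that some translate of `G` lies in `H`. -/
lemma mem_tightClosure_of_exists {F : Set H} (hF : F.Finite) {G : AddSubmonoid (σ →₀ ℕ)} (c : H)
    (hc : ∀ g ∈ G, c + g ∈ H) {f : R}
    (hf : ∀ n, coeff n (algebraMap R (MvPowerSeries σ k) f) ≠ 0 → ∃ a ∈ F, ∃ g ∈ G, a + g = n) :
    f ∈ tightClosure p (monoIdeal k R F) := by
  have hdom : IsDomain R := IsMonoidSeries.isDomain (k := k) (H := H) inferInstance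
  refine ⟨mono k H R c, fun P hP h => ?_, Filter.Eventually.of_forall fun e => ?_⟩
  · rw [IsDomain.minimalPrimes_eq_singleton_bot, Set.mem_singleton_iff] at hP
    rw [hP, Ideal.mem_bot] at h
    have := congrArg (fun r : R => coeff (c : σ →₀ ℕ) (algebraMap R (MvPowerSeries σ k) r)) h
    simp at this
  -- It suffices to use the `p ^ e`-th powers of the generators: exponents of the product with the
  -- multiplier are `c + p ^ e • (a + g)`, and `c + p ^ e • g` is in `H`.
  · have hle : monoIdeal k R ((fun a => p ^ e • a) '' F) ≤
        Ideal.span ((fun a : R => a ^ p ^ e) '' (monoIdeal k R F : Set R)) := by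
      rw [monoIdeal, Ideal.span_le]
      rintro _ ⟨_, ⟨a, ha, rfl⟩, rfl⟩
      exact Ideal.subset_span ⟨mono k H R a, Ideal.subset_span ⟨a, ha, rfl⟩, mono_pow a _⟩
    refine hle ((mem_monoIdeal (hF.image _)).2 fun n hn => ?_)
    rw [map_mul, map_pow, IsMonoidSeries.map_mono] at hn
    obtain ⟨u, v, rfl, hu, hv⟩ := exists_add_eq_of_coeff_mul_ne_zero hn
    obtain rfl := eq_of_coeff_monomial_ne_zero hu
    obtain ⟨w, rfl, hw⟩ := exists_of_coeff_pow_ne_zero p hv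
    obtain ⟨a, ha, g, hg, rfl⟩ := hf w hw
    refine ⟨_, ⟨a, ha, rfl⟩, c + p ^ e • g, hc _ (nsmul_mem hg _), ?_⟩
    simp only [AddSubmonoidClass.coe_nsmul, nsmul_add]
    abel

end TightClosure

/-! ### Powers of the ideals generated by powers of `X` and `Y` -/

section Powers

variable {H : AddSubmonoid (Fin 2 →₀ ℕ)} {N : ℕ}

/-- The exponents of `X ^ N` and `Y ^ N`. -/
def pairExponents (hx : expo N 0 ∈ H) (hy : expo 0 N ∈ H) : Set H := {⟨_, hx⟩, ⟨_, hy⟩}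

lemma pairExponents_finite (hx : expo N 0 ∈ H) (hy : expo 0 N ∈ H) :
    (pairExponents hx hy).Finite := by
  unfold pairExponents
  exact Set.toFinite _

lemma mem_nsmul_pairExponents (hx : expo N 0 ∈ H) (hy : expo 0 N ∈ H) {n : ℕ} {a : H} :
    a ∈ n • pairExponents hx hy ↔ ∃ i j, i + j = n ∧ (a : Fin 2 →₀ ℕ) = expo (N * i) (N * j) := by
  induction n generalizing a with
  | zero =>
    rw [zero_nsmul, Set.mem_zero]
    constructor
    · rintro rfl
      exact ⟨0, 0, rfl, exponent_ext (by simp) (by simp)⟩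
    · rintro ⟨i, j, hij, h⟩
      refine Subtype.ext ?_
      rw [h, (by omega : i = 0), (by omega : j = 0)]
      exact exponent_ext (by simp) (by simp)
  | succ n ih =>
    rw [succ_nsmul]
    constructor
    · rintro ⟨b, hb, c, hc, rfl⟩
      obtain ⟨i, j, hij, h⟩ := ih.1 hb
      rcases hc with rfl | rfl
      · exact ⟨i + 1, j, by omega, exponent_ext (by simp [h, mul_add]) (by simp [h])⟩
      · exact ⟨i, j + 1, by omega, exponent_ext (by simp [h]) (by simp [h, mul_add])⟩
    · rintro ⟨i, j, hij, h⟩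
      have hmem : ∀ i j, expo (N * i) (N * j) ∈ H := by
        intro i j
        have : expo (N * i) (N * j) = i • expo N 0 + j • expo 0 N :=
          exponent_ext (by simp [mul_comm]) (by simp [mul_comm])
        rw [this]
        exact add_mem (nsmul_mem hx _) (nsmul_mem hy _)
      rcases i with _ | i
      · refine ⟨⟨_, hmem 0 n⟩, ih.2 ⟨0, n, by omega, rfl⟩, ⟨_, hy⟩, Or.inr rfl, Subtype.ext ?_⟩
        rw [h, (by omega : j = n + 1)]
        exact exponent_ext (by simp) (by simp [mul_add])
      · refine ⟨⟨_, hmem i j⟩, ih.2 ⟨i, j, by omega, rfl⟩, ⟨_, hx⟩, Or.inl rfl, Subtype.ext ?_⟩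
        rw [h]
        exact exponent_ext (by simp [mul_add]) (by simp)

end Powers

/-! ### Counting exponents -/

section Counting

lemma encard_setOf_exponent (U : Set (ℕ × ℕ)) :
    {m : Fin 2 →₀ ℕ | (m 0, m 1) ∈ U}.encard = U.encard := by
  refine Set.encard_preimage_of_injective_subset_range (f := fun m : Fin 2 →₀ ℕ => (m 0, m 1)) ?_ ?_
  · intro m n h
    simp only [Prod.mk.injEq] at h
    exact exponent_ext h.1 h.2
  · rintro ⟨a, b⟩ -
    exact ⟨expo a b, by simp⟩

/-- The number of pairs with prescribed residues and quotients modulo `N`. -/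
lemma encard_residues {N : ℕ} (T ρ : Finset (ℕ × ℕ)) (hρ : ∀ r ∈ ρ, r.1 < N ∧ r.2 < N) :
    {x : ℕ × ℕ | (x.1 / N, x.2 / N) ∈ T ∧ (x.1 % N, x.2 % N) ∈ ρ}.encard =
      (T.card * ρ.card : ℕ) := by
  rw [← Finset.card_product, ← Set.encard_coe_eq_coe_finsetCard]
  refine (congrArg Set.encard ?_).trans (Set.encard_preimage_of_injective_subset_range
    (f := fun x : ℕ × ℕ => ((x.1 / N, x.2 / N), (x.1 % N, x.2 % N))) ?_ ?_)
  · ext x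
    simp
  · rintro ⟨a, b⟩ ⟨c, d⟩ h
    simp only [Prod.mk.injEq] at h
    obtain ⟨⟨h1, h2⟩, h3, h4⟩ := h
    rw [← Nat.div_add_mod a N, ← Nat.div_add_mod b N, h1, h2, h3, h4, Nat.div_add_mod,
      Nat.div_add_mod]
  · rintro ⟨⟨i, j⟩, r, s⟩ h
    have h1 := hρ (r, s) (by simpa using (Finset.mem_product.1 h).2)
    simp only at h1
    refine ⟨(N * i + r, N * j + s), ?_⟩
    have hN : 0 < N := by omega
    simp [Nat.mul_add_div hN, Nat.div_eq_of_lt h1.1, Nat.div_eq_of_lt h1.2,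
      Nat.mod_eq_of_lt h1.1, Nat.mod_eq_of_lt h1.2]

/-- The pairs of natural numbers with sum less than `n`. -/
def triangle (n : ℕ) : Finset (ℕ × ℕ) :=
  (Finset.range n ×ˢ Finset.range n).filter fun x => x.1 + x.2 < n

lemma mem_triangle {n : ℕ} {x : ℕ × ℕ} : x ∈ triangle n ↔ x.1 + x.2 < n := by
  simp only [triangle, Finset.mem_filter, Finset.mem_product, Finset.mem_range]
  omega

lemma card_triangle (n : ℕ) : (triangle n).card = (n + 1).choose 2 := by
  induction n with
  | zero => rfl
  | succ n ih =>
    have h : triangle (n + 1) = triangle n ∪ Finset.HasAntidiagonal.antidiagonal n := by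
      ext x
      rw [Finset.mem_union, mem_triangle, mem_triangle, Finset.HasAntidiagonal.mem_antidiagonal]
      omega
    have hd : Disjoint (triangle n) (Finset.HasAntidiagonal.antidiagonal n) := by
      rw [Finset.disjoint_left]
      intro x hx hx'
      rw [mem_triangle] at hx
      rw [Finset.HasAntidiagonal.mem_antidiagonal] at hx'
      omega
    rw [h, Finset.card_union_of_disjoint hd, ih, Finset.Nat.card_antidiagonal,
      Nat.choose_succ_succ' (n + 1) 1, Nat.choose_one_right, add_comm]

/-- Counting by completion: the exponents `A` of a quotient of `R`, together with missing exponents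
`B`, form a regular block `C` and a correction `D` near its boundary. -/
lemma encard_add_eq_of_union_eq {α : Type*} {A B C D : Set α} (h : A ∪ B = C ∪ D)
    (hAB : Disjoint A B) (hCD : Disjoint C D) {b c d : ℕ} (hB : B.encard = b) (hC : C.encard = c)
    (hD : D.encard = d) : A.encard = (c + d - b : ℕ) := by
  have h1 : A.encard + b = c + d := by
    rw [← hB, ← hC, ← hD, ← Set.encard_union_eq hAB, ← Set.encard_union_eq hCD, h]
  have h2 : A.encard ≠ ⊤ := by
    intro e
    rw [e, top_add] at h1
    exact absurd h1.symm (by exact_mod_cast ENat.natCast_ne_top (c + d))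
  obtain ⟨a, ha⟩ := ENat.ne_top_iff_exists.1 h2
  rw [← ha] at h1 ⊢
  norm_cast at h1 ⊢
  omega

/-- The exponents in `S` that are missing in `R`. -/
def missing : Finset (ℕ × ℕ) := {(3, 2), (2, 3), (3, 7), (7, 3)}

lemma mem_monoidR_iff' {m : Fin 2 →₀ ℕ} :
    m ∈ monoidR ↔ 5 ∣ m 0 + m 1 ∧ (m 0, m 1) ∉ missing := by
  rw [mem_monoidR_iff]
  simp [missing]

lemma encard_missing : (missing : Set (ℕ × ℕ)).encard = (4 : ℕ) := by
  rw [Set.encard_coe_eq_coe_finsetCard]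
  rfl

/-- The residues modulo `N` of the exponents in `S`. -/
def residues (N : ℕ) : Finset (ℕ × ℕ) :=
  (Finset.range N ×ˢ Finset.range N).filter fun x => 5 ∣ x.1 + x.2

lemma residues_lt {N : ℕ} : ∀ r ∈ residues N, r.1 < N ∧ r.2 < N := by
  intro r hr
  simp only [residues, Finset.mem_filter, Finset.mem_product, Finset.mem_range] at hr
  exact hr.1

end Counting

/-! ### Lengths of the quotients by powers of `(X ^ 5, Y ^ 5)` and `(X ^ 10, Y ^ 10)` -/

lemma expo_mem_monoidR_left {N : ℕ} (h : 5 ∣ N) : expo N 0 ∈ monoidR := by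
  rw [mem_monoidR_iff]
  simpa using h

lemma expo_mem_monoidR_right {N : ℕ} (h : 5 ∣ N) : expo 0 N ∈ monoidR := by
  rw [mem_monoidR_iff]
  simpa using h

/-- The exponents of `X ^ N` and `Y ^ N` in `R`. -/
noncomputable def pairR {N : ℕ} (h : 5 ∣ N) : Set monoidR :=
  pairExponents (expo_mem_monoidR_left h) (expo_mem_monoidR_right h)

lemma pairR_finite {N : ℕ} (h : 5 ∣ N) : (pairR h).Finite := pairExponents_finite _ _

/-- After removing `(5i, 5j)` with `i + j = n`, the rest must not be missing. For residue 3 the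
missing rests have quotients (0,0) and (0,1), so the surplus of the quotients over `n` must be at
least two, or one placed in the first coordinate. Residue 2 is symmetric. -/
lemma exists_mem_pairR_five {n : ℕ} {m : Fin 2 →₀ ℕ} :
    (∃ a ∈ n • pairR (dvd_refl 5), ∃ h ∈ monoidR, (a : Fin 2 →₀ ℕ) + h = m) ↔
      5 ∣ m 0 + m 1 ∧ n ≤ m 0 / 5 + m 1 / 5 ∧
      (m 0 % 5 = 3 → n + 2 ≤ m 0 / 5 + m 1 / 5 ∨ n + 1 = m 0 / 5 + m 1 / 5 ∧ 1 ≤ m 0 / 5) ∧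
      (m 0 % 5 = 2 → n + 2 ≤ m 0 / 5 + m 1 / 5 ∨ n + 1 = m 0 / 5 + m 1 / 5 ∧ 1 ≤ m 1 / 5) := by
  constructor
  · rintro ⟨a, ha, h, hh, rfl⟩
    obtain ⟨i, j, hij, e⟩ := (mem_nsmul_pairExponents _ _).1 ha
    rw [mem_monoidR_iff] at hh
    rw [e]
    simp only [Finsupp.add_apply, expo_apply_zero, expo_apply_one]
    omega
  · rintro ⟨hd, hn, h3, h2⟩
    have key : ∀ i j, i + j = n → 5 * i ≤ m 0 → 5 * j ≤ m 1 →
        expo (m 0 - 5 * i) (m 1 - 5 * j) ∈ monoidR →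
        ∃ a ∈ n • pairR (dvd_refl 5), ∃ h ∈ monoidR, (a : Fin 2 →₀ ℕ) + h = m := by
      intro i j hij hi hj hmem
      have hij' : expo (5 * i) (5 * j) ∈ monoidR := by
        rw [mem_monoidR_iff]
        simp only [expo_apply_zero, expo_apply_one]
        omega
      refine ⟨⟨_, hij'⟩, (mem_nsmul_pairExponents _ _).2 ⟨i, j, hij, rfl⟩, _, hmem, ?_⟩
      apply exponent_ext <;> simp <;> omega
    by_cases e3 : m 0 % 5 = 3
    · specialize h3 e3
      -- Subtracting one leaves a surplus block in the first coordinate whenever possible. If `m 0 /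
      -- 5 = 0`, truncation gives `i = 0`, and the surplus of at least two falls into the second
      -- coordinate.
      refine key (min (m 0 / 5 - 1) n) (n - min (m 0 / 5 - 1) n) (by omega) (by omega) (by omega) ?_
      rw [mem_monoidR_iff]
      simp only [expo_apply_zero, expo_apply_one]
      omega
    · by_cases e2 : m 0 % 5 = 2
      · specialize h2 e2
        refine key (n - min (m 1 / 5 - 1) n) (min (m 1 / 5 - 1) n) (by omega) (by omega) (by omega)
          ?_
        rw [mem_monoidR_iff]
        simp only [expo_apply_zero, expo_apply_one]
        omega
      · refine key (min (m 0 / 5) n) (n - min (m 0 / 5) n) (by omega) (by omega) (by omega) ?_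
        rw [mem_monoidR_iff]
        simp only [expo_apply_zero, expo_apply_one]
        omega

/-- All four missing exponents lie in the single box `[0,10)²`, so an obstruction occurs only when
the quotients add up to exactly `n`, without surplus. -/
lemma exists_mem_pairR_ten {n : ℕ} {m : Fin 2 →₀ ℕ} :
    (∃ a ∈ n • pairR (N := 10) (by norm_num), ∃ h ∈ monoidR, (a : Fin 2 →₀ ℕ) + h = m) ↔
      5 ∣ m 0 + m 1 ∧ n ≤ m 0 / 10 + m 1 / 10 ∧
      (n = m 0 / 10 + m 1 / 10 → (m 0 % 10, m 1 % 10) ∉ missing) := by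
  constructor
  · rintro ⟨a, ha, h, hh, rfl⟩
    obtain ⟨i, j, hij, e⟩ := (mem_nsmul_pairExponents _ _).1 ha
    rw [mem_monoidR_iff] at hh
    rw [e]
    simp only [Finsupp.add_apply, expo_apply_zero, expo_apply_one, missing, Finset.mem_insert,
      Finset.mem_singleton, Prod.mk.injEq]
    refine ⟨by omega, by omega, fun h1 => ?_⟩
    have h2 : h 0 < 10 := by omega
    have h3 : h 1 < 10 := by omega
    rw [Nat.mul_add_mod, Nat.mul_add_mod, Nat.mod_eq_of_lt h2, Nat.mod_eq_of_lt h3]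
    tauto
  · rintro ⟨hd, hn, h1⟩
    simp only [missing, Finset.mem_insert, Finset.mem_singleton, Prod.mk.injEq] at h1
    set i := min (m 0 / 10) n with hi
    have hij : expo (10 * i) (10 * (n - i)) ∈ monoidR := by
      rw [mem_monoidR_iff]
      simp only [expo_apply_zero, expo_apply_one]
      omega
    refine ⟨⟨_, hij⟩, (mem_nsmul_pairExponents _ _).2 ⟨i, n - i, by omega, rfl⟩,
      expo (m 0 - 10 * i) (m 1 - 10 * (n - i)), ?_, ?_⟩
    · rw [mem_monoidR_iff]
      simp only [expo_apply_zero, expo_apply_one]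
      by_cases h2 : n = m 0 / 10 + m 1 / 10
      · have := h1 h2
        omega
      · omega
    · apply exponent_ext <;> simp <;> omega

section Length

variable {k : Type*} [Field k] {R : Type*} [CommRing R] [Algebra R (MvPowerSeries (Fin 2) k)]
  [IsMonoidSeries k monoidR R] [IsLocalRing R]

variable (k R) in
lemma length_quotient_monoIdeal {F : Set monoidR} (hF : F.Finite) {C : Set (ℕ × ℕ)}
    (hC : ∀ m : Fin 2 →₀ ℕ, (m 0, m 1) ∈ C ↔
      m ∈ monoidR ∧ ¬ ∃ a ∈ F, ∃ h ∈ monoidR, (a : Fin 2 →₀ ℕ) + h = m)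
    {l : ℕ} (hl : C.encard = l) : Module.length R (R ⧸ monoIdeal k R F) = l := by
  refine length_quotient_ideal k monoidR R (A := {m | ∃ a ∈ F, ∃ h ∈ monoidR, (a : Fin 2 →₀ ℕ) + h = m})
    ?_ ?_ (fun f => mem_monoIdeal hF) ?_
  · rintro h hh _ ⟨a, ha, g, hg, rfl⟩
    exact ⟨a, ha, h + g, add_mem hh hg, by abel⟩
  · rintro _ ⟨a, ha, g, hg, rfl⟩
    exact add_mem a.2 hg
  · rw [← hl, ← encard_setOf_exponent C]
    congr 1
    ext m
    exact (hC m).symm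

variable (k R) in
/-- The Hilbert function of `(X ^ 5, Y ^ 5)`. -/
lemma length_quotient_pairR_five_pow {n : ℕ} (hn : 1 ≤ n) :
    Module.length R (R ⧸ monoIdeal k R (pairR (dvd_refl 5)) ^ n) =
      (5 * (n + 1).choose 2 + 2 * n : ℕ) := by
  classical
  rw [monoIdeal_pow]
  -- For residues (3,2) the blocks outside the triangle that still miss `Q ^ n` are those of surplus
  -- zero and the block (0, n + 1), whose surplus lies in the wrong coordinate. `T₂` is its mirror
  -- image.
  let T₃ : Finset (ℕ × ℕ) := insert (0, n + 1) (Finset.HasAntidiagonal.antidiagonal n)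
  let T₂ : Finset (ℕ × ℕ) := insert (n + 1, 0) (Finset.HasAntidiagonal.antidiagonal n)
  have hT₃ : T₃.card = n + 2 := by
    rw [Finset.card_insert_of_notMem (by simp), Finset.Nat.card_antidiagonal]
  have hT₂ : T₂.card = n + 2 := by
    rw [Finset.card_insert_of_notMem (by simp), Finset.Nat.card_antidiagonal]
  let D : Set (ℕ × ℕ) :=
    {x | (x.1 / 5, x.2 / 5) ∈ triangle n ∧ (x.1 % 5, x.2 % 5) ∈ residues 5}
  let B₃ : Set (ℕ × ℕ) := {x | (x.1 / 5, x.2 / 5) ∈ T₃ ∧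
    (x.1 % 5, x.2 % 5) ∈ ({(3, 2)} : Finset (ℕ × ℕ))}
  let B₂ : Set (ℕ × ℕ) := {x | (x.1 / 5, x.2 / 5) ∈ T₂ ∧
    (x.1 % 5, x.2 % 5) ∈ ({(2, 3)} : Finset (ℕ × ℕ))}
  have hD : D.encard = (5 * (n + 1).choose 2 : ℕ) := by
    rw [encard_residues _ _ residues_lt, card_triangle, mul_comm]
    rfl
  have hB₃ : B₃.encard = (n + 2 : ℕ) := by
    rw [encard_residues _ _ (by simp), hT₃]
    simp
  have hB₂ : B₂.encard = (n + 2 : ℕ) := by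
    rw [encard_residues _ _ (by simp), hT₂]
    simp
  have hB : (B₃ ∪ B₂).encard = (2 * (n + 2) : ℕ) := by
    rw [Set.encard_union_eq, hB₃, hB₂, ← Nat.cast_add, two_mul]
    rw [Set.disjoint_left]
    rintro x ⟨-, h1⟩ ⟨-, h2⟩
    simp only [Finset.mem_singleton] at h1 h2
    rw [h1] at h2
    simp at h2
  let C : Set (ℕ × ℕ) := {x | (5 ∣ x.1 + x.2 ∧ x ∉ missing) ∧
    ¬ (5 ∣ x.1 + x.2 ∧ n ≤ x.1 / 5 + x.2 / 5 ∧
      (x.1 % 5 = 3 → n + 2 ≤ x.1 / 5 + x.2 / 5 ∨ n + 1 = x.1 / 5 + x.2 / 5 ∧ 1 ≤ x.1 / 5) ∧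
      (x.1 % 5 = 2 → n + 2 ≤ x.1 / 5 + x.2 / 5 ∨ n + 1 = x.1 / 5 + x.2 / 5 ∧ 1 ≤ x.2 / 5))}
  have hC : C.encard = (5 * (n + 1).choose 2 + 2 * (n + 2) - 4 : ℕ) := by
    refine encard_add_eq_of_union_eq (A := C) (B := missing) (C := D) (D := B₃ ∪ B₂) ?_ ?_ ?_
      encard_missing hD hB
    · ext ⟨a, b⟩
      simp only [C, D, B₃, B₂, T₃, T₂, missing, residues, mem_triangle, Set.mem_union,
        Set.mem_ofPred_eq, Finset.coe_insert, Finset.coe_singleton, Set.mem_insert_iff,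
        Set.mem_singleton_iff, Finset.mem_insert, Finset.mem_singleton, Prod.mk.injEq,
        Finset.mem_filter, Finset.mem_product, Finset.mem_range,
        Finset.HasAntidiagonal.mem_antidiagonal]
      omega
    · rw [Set.disjoint_left]
      rintro x ⟨⟨-, h⟩, -⟩ h'
      exact h h'
    · rw [Set.disjoint_left]
      rintro ⟨a, b⟩ ⟨h, -⟩ (⟨h', -⟩ | ⟨h', -⟩)
      all_goals
        simp only [T₃, T₂, mem_triangle, Finset.mem_insert, Prod.mk.injEq,
          Finset.HasAntidiagonal.mem_antidiagonal] at h h'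
        omega
  refine length_quotient_monoIdeal k R (finite_nsmul (pairR_finite _) n) (C := C) ?_ ?_
  · intro m
    rw [exists_mem_pairR_five, mem_monoidR_iff']
    rfl
  · rw [hC]
    congr 1

variable (k R) in
/-- The Hilbert function of `(X ^ 10, Y ^ 10)`. -/
lemma length_quotient_pairR_ten_pow {n : ℕ} (hn : 1 ≤ n) :
    Module.length R (R ⧸ monoIdeal k R (pairR (N := 10) (by norm_num)) ^ n) =
      (20 * (n + 1).choose 2 + 4 * n : ℕ) := by
  classical
  rw [monoIdeal_pow]
  let D : Set (ℕ × ℕ) :=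
    {x | (x.1 / 10, x.2 / 10) ∈ triangle n ∧ (x.1 % 10, x.2 % 10) ∈ residues 10}
  -- Each of the `n + 1` boxes on the antidiagonal contributes four exponents to the correction.
  let B : Set (ℕ × ℕ) := {x | (x.1 / 10, x.2 / 10) ∈ Finset.HasAntidiagonal.antidiagonal n ∧
    (x.1 % 10, x.2 % 10) ∈ missing}
  have hD : D.encard = (20 * (n + 1).choose 2 : ℕ) := by
    rw [encard_residues _ _ residues_lt, card_triangle, mul_comm]
    rfl
  have hB : B.encard = (4 * (n + 1) : ℕ) := by
    rw [encard_residues _ _ (by decide), Finset.Nat.card_antidiagonal, mul_comm]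
    rfl
  let C : Set (ℕ × ℕ) := {x | (5 ∣ x.1 + x.2 ∧ x ∉ missing) ∧
    ¬ (5 ∣ x.1 + x.2 ∧ n ≤ x.1 / 10 + x.2 / 10 ∧
      (n = x.1 / 10 + x.2 / 10 → (x.1 % 10, x.2 % 10) ∉ missing))}
  have hC : C.encard = (20 * (n + 1).choose 2 + 4 * (n + 1) - 4 : ℕ) := by
    refine encard_add_eq_of_union_eq (A := C) (B := missing) (C := D) (D := B) ?_ ?_ ?_
      encard_missing hD hB
    · ext ⟨a, b⟩
      simp only [C, D, B, missing, residues, mem_triangle, Set.mem_union,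
        Set.mem_ofPred_eq, Finset.coe_insert, Finset.coe_singleton, Set.mem_insert_iff,
        Set.mem_singleton_iff, Finset.mem_insert, Finset.mem_singleton, Prod.mk.injEq,
        Finset.mem_filter, Finset.mem_product, Finset.mem_range,
        Finset.HasAntidiagonal.mem_antidiagonal]
      omega
    · rw [Set.disjoint_left]
      rintro x ⟨⟨-, h⟩, -⟩ h'
      exact h h'
    · rw [Set.disjoint_left]
      rintro ⟨a, b⟩ ⟨h, -⟩ ⟨h', -⟩
      simp only [mem_triangle, Finset.HasAntidiagonal.mem_antidiagonal] at h h'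
      omega
  refine length_quotient_monoIdeal k R (finite_nsmul (pairR_finite _) n) (C := C) ?_ ?_
  · intro m
    rw [exists_mem_pairR_ten, mem_monoidR_iff']
    rfl
  · rw [hC]
    congr 1

end Length

/-! ### Tight closures of the powers of `(X ^ 5, Y ^ 5)` and their colengths. -/

section TightLength

variable {k : Type*} [Field k] {R : Type*} [CommRing R] [Algebra R (MvPowerSeries (Fin 2) k)]
  [IsMonoidSeries k monoidR R] (p : ℕ) [Fact p.Prime] [CharP k p] [CharP R p]

variable (k) in
/-- The tight closures of the powers of `(X ^ 5, Y ^ 5)`. -/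
lemma mem_tightClosure_pairR_pow (n : ℕ) {f : R} :
    f ∈ tightClosure p (monoIdeal k R (pairR (dvd_refl 5)) ^ n) ↔
      ∀ m, coeff m (algebraMap R (MvPowerSeries (Fin 2) k) f) ≠ 0 →
        m ∈ monoidR ∧ n ≤ m 0 / 5 + m 1 / 5 := by
  rw [monoIdeal_pow]
  have hfin := finite_nsmul (pairR_finite (dvd_refl 5)) n
  constructor
  · intro hf m hm
    refine ⟨mem_of_coeff_ne_zero k monoidR f hm, ?_⟩
    obtain ⟨a, ha, ham⟩ := exists_le_of_mem_tightClosure p hfin hf hm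
    obtain ⟨i, j, hij, e⟩ := (mem_nsmul_pairExponents _ _).1 ha
    rw [e] at ham
    have h0 := ham 0
    have h1 := ham 1
    simp only [expo_apply_zero, expo_apply_one] at h0 h1
    omega
  · intro hf
    -- The multiplier `X ^ 15` carries `S` into `R`, because every missing exponent has first
    -- coordinate at most 7.
    refine mem_tightClosure_of_exists p hfin (G := monoidS)
      ⟨expo 15 0, expo_mem_monoidR_left (by norm_num)⟩ ?_ ?_
    · intro g hg
      rw [mem_monoidS_iff] at hg
      rw [mem_monoidR_iff]
      simp only [Finsupp.add_apply, expo_apply_zero, expo_apply_one]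
      omega
    · intro m hm
      obtain ⟨h1, h2⟩ := hf m hm
      rw [mem_monoidR_iff] at h1
      set i := min (m 0 / 5) n with hi
      have hij : expo (5 * i) (5 * (n - i)) ∈ monoidR := by
        rw [mem_monoidR_iff]
        simp only [expo_apply_zero, expo_apply_one]
        omega
      refine ⟨⟨_, hij⟩, (mem_nsmul_pairExponents _ _).2 ⟨i, n - i, by omega, rfl⟩,
        expo (m 0 - 5 * i) (m 1 - 5 * (n - i)), expo_mem_monoidS (by omega), ?_⟩
      apply exponent_ext <;> simp <;> omega

variable (k R) in
lemma length_quotient_tightClosure [IsLocalRing R] {n l : ℕ}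
    (hl : {x : ℕ × ℕ | (5 ∣ x.1 + x.2 ∧ x ∉ missing) ∧ x.1 / 5 + x.2 / 5 < n}.encard = l) :
    Module.length R (R ⧸ tightClosure p (monoIdeal k R (pairR (dvd_refl 5)) ^ n)) = l := by
  refine length_quotient_ideal k monoidR R (A := {m | m ∈ monoidR ∧ n ≤ m 0 / 5 + m 1 / 5})
    ?_ (fun m hm => hm.1) (fun f => mem_tightClosure_pairR_pow k p n) ?_
  · rintro h hh a ⟨ha, hn⟩
    refine ⟨add_mem hh ha, ?_⟩
    simp only [Finsupp.add_apply]
    omega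
  · rw [← hl, ← encard_setOf_exponent]
    congr 1
    ext m
    simp only [Set.mem_sdiff, SetLike.mem_coe, Set.mem_ofPred_eq, mem_monoidR_iff']
    constructor
    · rintro ⟨h1, h2⟩
      exact ⟨h1, by by_contra h; exact h2 ⟨h1, by omega⟩⟩
    · rintro ⟨h1, h2⟩
      exact ⟨h1, fun h => by omega⟩

lemma encard_quotient_lt (n : ℕ) :
    {x : ℕ × ℕ | 5 ∣ x.1 + x.2 ∧ x.1 / 5 + x.2 / 5 < n}.encard = (5 * (n + 1).choose 2 : ℕ) := by
  have h := encard_residues (N := 5) (triangle n) (residues 5) residues_lt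
  rw [card_triangle, mul_comm] at h
  refine (congrArg Set.encard ?_).trans h
  ext ⟨a, b⟩
  simp only [residues, mem_triangle, Set.mem_ofPred_eq, Finset.mem_filter, Finset.mem_product,
    Finset.mem_range]
  omega

variable (k R) in
/-- The tight Hilbert function of `(X ^ 5, Y ^ 5)`. -/
lemma length_quotient_tightClosure_pow [IsLocalRing R] {n : ℕ} (hn : 2 ≤ n) :
    Module.length R (R ⧸ tightClosure p (monoIdeal k R (pairR (dvd_refl 5)) ^ n)) =
      (5 * (n + 1).choose 2 - 4 : ℕ) := by
  refine length_quotient_tightClosure k R p ?_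
  -- The quotients of a missing exponent by 5 add up to at most 1, so for `n ≥ 2` all four lie in
  -- the counted region.
  refine encard_add_eq_of_union_eq (B := missing) (D := ∅) (d := 0) ?_ ?_ ?_
      encard_missing (encard_quotient_lt n) (by simp)
  · ext ⟨a, b⟩
    simp only [missing, Set.mem_union, Set.mem_ofPred_eq, Finset.coe_insert, Finset.coe_singleton,
      Set.mem_insert_iff, Set.mem_singleton_iff, Finset.mem_insert, Finset.mem_singleton,
      Prod.mk.injEq, Set.mem_empty_iff_false, or_false]
    omega
  · rw [Set.disjoint_left]
    rintro x ⟨⟨-, h⟩, -⟩ h'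
    exact h h'
  · simp

variable (k R) in
-- For `n = 1` only (3,2) and (2,3) lie in the region, which leaves `5 - 2` exponents; the general
-- formula would subtract four.
lemma length_quotient_tightClosure_one [IsLocalRing R] :
    Module.length R (R ⧸ tightClosure p (monoIdeal k R (pairR (dvd_refl 5)))) = (3 : ℕ) := by
  have := length_quotient_tightClosure k R p (n := 1) (l := 3) ?_
  · rwa [pow_one] at this
  have h2 : (({(3, 2), (2, 3)} : Finset (ℕ × ℕ)) : Set (ℕ × ℕ)).encard = (2 : ℕ) := by
    rw [Set.encard_coe_eq_coe_finsetCard]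
    rfl
  refine encard_add_eq_of_union_eq (c := 5) (D := ∅) (d := 0) ?_ ?_ ?_
      h2 (encard_quotient_lt 1) (by simp)
  · ext ⟨a, b⟩
    simp only [missing, Set.mem_union, Set.mem_ofPred_eq, Finset.coe_insert, Finset.coe_singleton,
      Set.mem_insert_iff, Set.mem_singleton_iff, Finset.mem_insert, Finset.mem_singleton,
      Prod.mk.injEq, Set.mem_empty_iff_false, or_false]
    omega
  · rw [Set.disjoint_left]
    rintro x ⟨⟨-, h⟩, -⟩ h'
    have hsub : ({(3, 2), (2, 3)} : Finset (ℕ × ℕ)) ⊆ missing := by decide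
    exact h (hsub h')
  · simp

end TightLength

/-! ### Lengths and regular sequences -/

section ModuleLength

variable {R : Type*} [CommRing R] {M : Type*} [AddCommGroup M] [Module R M]

lemma length_le_add_of_exact {N P : Type*} [AddCommGroup N] [Module R N] [AddCommGroup P]
    [Module R P] (f : N →ₗ[R] M) (g : M →ₗ[R] P) (hg : Function.Surjective g)
    (h : Function.Exact f g) :
    Module.length R M ≤ Module.length R N + Module.length R P := by
  rw [Module.length_eq_add_of_exact (LinearMap.ker g).subtype g (Submodule.subtype_injective _) hg
    (LinearMap.exact_subtype_ker_map g)]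
  gcongr
  refine Module.length_le_of_surjective
    (f.codRestrict (LinearMap.ker g) fun x => (h (f x)).2 ⟨x, rfl⟩) ?_
  rintro ⟨y, hy⟩
  obtain ⟨x, hx⟩ := (h y).1 hy
  exact ⟨x, Subtype.ext hx⟩

/-- Right exactness of `M/P → M/P' → M/(P' + cM) → 0`, with first map multiplication by `c`; the
next two length comparisons rest on it. -/
lemma mapQ_factor_exact {c : R} {P P' : Submodule R M} 
    (hle : P ≤ P'.comap (LinearMap.lsmul R M c)) :
    Function.Exact (P.mapQ P' (LinearMap.lsmul R M c) hle)
      (Submodule.factor (le_sup_left : P' ≤ P' ⊔ c • ⊤)) := by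
  intro y
  induction y using Submodule.Quotient.induction_on with
  | _ y =>
  have h1 : Submodule.factor (le_sup_left : P' ≤ P' ⊔ c • ⊤) (Submodule.Quotient.mk y) =
    Submodule.Quotient.mk y := rfl
  rw [h1, Submodule.Quotient.mk_eq_zero]
  constructor
  · intro hy
    obtain ⟨u, hu, v, hv, rfl⟩ := Submodule.mem_sup.1 hy
    obtain ⟨z, -, rfl⟩ := (Submodule.mem_smul_pointwise_iff_exists _ _ _).1 hv
    refine ⟨Submodule.Quotient.mk z, ?_⟩
    rw [Submodule.mapQ_apply, eq_comm, Submodule.Quotient.eq, LinearMap.lsmul_apply,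
      add_sub_cancel_right]
    exact hu
  · rintro ⟨z, hz⟩
    induction z using Submodule.Quotient.induction_on with
    | _ z =>
    rw [Submodule.mapQ_apply, eq_comm, Submodule.Quotient.eq, LinearMap.lsmul_apply] at hz
    have h2 : c • z ∈ c • (⊤ : Submodule R M) := Submodule.smul_mem_pointwise_smul _ _ _ trivial
    exact Submodule.mem_sup.2 ⟨_, hz, _, h2, by abel⟩

/-- The hypothesis says that `P` is the colon of `P'` by `c`, so multiplication by `c` is injective
on `M/P` and lengths add. -/
lemma length_quotient_eq_add_of_smul {c : R} {P P' : Submodule R M} (h : ∀ x, c • x ∈ P' ↔ x ∈ P) :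
    Module.length R (M ⧸ P') =
      Module.length R (M ⧸ P) + Module.length R (M ⧸ P' ⊔ c • (⊤ : Submodule R M)) := by
  have hle : P ≤ P'.comap (LinearMap.lsmul R M c) := fun x hx => (h x).2 hx
  refine Module.length_eq_add_of_exact (P.mapQ P' (LinearMap.lsmul R M c) hle)
    (Submodule.factor le_sup_left) ?_ (Submodule.factor_surjective _) (mapQ_factor_exact _)
  rw [← LinearMap.ker_eq_bot, Submodule.ker_mapQ, ← le_bot_iff, Submodule.map_le_iff_le_comap,
    Submodule.comap_bot, Submodule.ker_mkQ]
  exact fun x hx => (h x).1 hx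

/-- Measures the cost of replacing `cN` by `cM`. It is applied once per parameter to pass from `R`
to `S`. -/
lemma length_quotient_sup_smul_le (c : R) (P N : Submodule R M) :
    Module.length R (M ⧸ P ⊔ c • N) ≤
      Module.length R (M ⧸ N) + Module.length R (M ⧸ P ⊔ c • (⊤ : Submodule R M)) := by
  have hle : N ≤ (P ⊔ c • N).comap (LinearMap.lsmul R M c) := fun x hx =>
    Submodule.mem_sup_right (Submodule.smul_mem_pointwise_smul _ _ _ hx)
  have h := length_le_add_of_exact _ _ (Submodule.factor_surjective _) (mapQ_factor_exact hle)
  have e : P ⊔ c • N ⊔ c • (⊤ : Submodule R M) = P ⊔ c • (⊤ : Submodule R M) := by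
    rw [sup_assoc, sup_eq_right.2 (smul_mono_right c le_top)]
  rwa [e] at h

lemma length_quotient_map_eq_add {N : Type*} [AddCommGroup N] [Module R N] (f : N →ₗ[R] M)
    (hf : Function.Injective f) (P : Submodule R N) :
    Module.length R (M ⧸ P.map f) =
      Module.length R (N ⧸ P) + Module.length R (M ⧸ LinearMap.range f) := by
  have hle : P.map f ≤ LinearMap.range f := LinearMap.map_le_range
  refine Module.length_eq_add_of_exact (P.mapQ (P.map f) f (Submodule.le_comap_map f P))
    (Submodule.factor hle) ?_ (Submodule.factor_surjective _) ?_
  · rw [← LinearMap.ker_eq_bot, Submodule.ker_mapQ, Submodule.comap_map_eq_of_injective hf,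
      ← le_bot_iff, Submodule.map_le_iff_le_comap, Submodule.comap_bot, Submodule.ker_mkQ]
  · intro y
    induction y using Submodule.Quotient.induction_on with
    | _ y =>
    have h1 : Submodule.factor hle (Submodule.Quotient.mk y) = Submodule.Quotient.mk y := rfl
    rw [h1, Submodule.Quotient.mk_eq_zero]
    constructor
    · rintro ⟨x, rfl⟩
      exact ⟨Submodule.Quotient.mk x, rfl⟩
    · rintro ⟨z, hz⟩
      induction z using Submodule.Quotient.induction_on with
      | _ z =>
      rw [Submodule.mapQ_apply, eq_comm, Submodule.Quotient.eq] at hz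
      have := add_mem (hle hz) (LinearMap.mem_range_self f z)
      simpa using this

variable {a b : R}

/-- The hypothesis is regularity of `b` on `M/aM`, written without quotients; regularity passes to
powers. -/
lemma exists_eq_smul_of_pow_smul (hb : ∀ x y : M, b • x = a • y → ∃ z, x = a • z) (n : ℕ) :
    ∀ x y : M, b ^ n • x = a • y → ∃ z, x = a • z := by
  induction n with
  | zero => exact fun x y h => ⟨y, by simpa using h⟩
  | succ n ih =>
    intro x y h
    rw [pow_succ, mul_smul] at h
    obtain ⟨z, hz⟩ := ih _ _ h
    exact hb _ _ hz

lemma mem_sup_smul_top {c : R} {x : M} :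
    x ∈ a • (⊤ : Submodule R M) ⊔ c • (⊤ : Submodule R M) ↔ ∃ y z, x = a • y + c • z := by
  rw [Submodule.mem_sup]
  constructor
  · rintro ⟨u, hu, v, hv, rfl⟩
    obtain ⟨y, -, rfl⟩ := (Submodule.mem_smul_pointwise_iff_exists _ _ _).1 hu
    obtain ⟨z, -, rfl⟩ := (Submodule.mem_smul_pointwise_iff_exists _ _ _).1 hv
    exact ⟨y, z, rfl⟩
  · rintro ⟨y, z, rfl⟩
    exact ⟨_, Submodule.smul_mem_pointwise_smul _ _ _ trivial, _,
      Submodule.smul_mem_pointwise_smul _ _ _ trivial, rfl⟩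

/-- By regularity the colon of `aM + b^(n+1)M` by `b` is `aM + b^n M`, so each step adds one copy of
the length for exponent one. -/
lemma length_quotient_sup_pow (hb : ∀ x y : M, b • x = a • y → ∃ z, x = a • z) (n : ℕ) :
    Module.length R (M ⧸ a • (⊤ : Submodule R M) ⊔ b ^ n • (⊤ : Submodule R M)) =
      n * Module.length R (M ⧸ a • (⊤ : Submodule R M) ⊔ b • (⊤ : Submodule R M)) := by
  induction n with
  | zero =>
    rw [pow_zero, one_smul, sup_top_eq, Nat.cast_zero, zero_mul, Module.length_eq_zero_iff]
    exact Submodule.Quotient.subsingleton_iff.2 rfl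
  | succ n ih =>
    rw [length_quotient_eq_add_of_smul (c := b)
      (P := a • (⊤ : Submodule R M) ⊔ b ^ n • (⊤ : Submodule R M)), ih]
    · have e : a • (⊤ : Submodule R M) ⊔ b ^ (n + 1) • (⊤ : Submodule R M) ⊔ b • ⊤ =
          a • ⊤ ⊔ b • ⊤ := by
        rw [sup_assoc, sup_eq_right (a := b ^ (n + 1) • (⊤ : Submodule R M)) |>.2]
        rw [pow_succ', mul_smul]
        exact smul_mono_right b le_top
      rw [e]
      push_cast
      ring
    · intro x
      rw [mem_sup_smul_top, mem_sup_smul_top]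
      constructor
      · rintro ⟨y, z, h⟩
        have h1 : b • (x - b ^ n • z) = a • y := by
          rw [smul_sub, h, smul_smul, ← pow_succ']
          abel
        obtain ⟨w, hw⟩ := hb _ _ h1
        exact ⟨w, z, by rw [← hw]; abel⟩
      · rintro ⟨y, z, rfl⟩
        refine ⟨b • y, z, ?_⟩
        rw [smul_add, smul_comm b a y, pow_succ', mul_smul]

/-- Among the monomials of degree `n + 1` in `a, b`, only `b^(n+1)` is not divisible by `a`. -/
lemma span_pair_pow_succ (a b : R) (n : ℕ) :
    Ideal.span {a, b} ^ (n + 1) =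
      Ideal.span {a} * Ideal.span {a, b} ^ n ⊔ Ideal.span {b ^ (n + 1)} := by
  induction n with
  | zero => simp [Ideal.span_insert, Ideal.one_eq_top]
  | succ n ih =>
    set Q := Ideal.span {a, b} with hQ
    have hQ' : Q = Ideal.span {a} ⊔ Ideal.span {b} := Ideal.span_insert _ _
    have h1 : Q ^ (n + 2) = Ideal.span {a} * Q ^ (n + 1) ⊔
        (Ideal.span {b} * (Ideal.span {a} * Q ^ n) ⊔ Ideal.span {b} * Ideal.span {b ^ (n + 1)}) := by
      rw [← Ideal.mul_sup, ← ih, ← Ideal.sup_mul, ← hQ', ← pow_succ']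
    have h2 : Ideal.span {b} * (Ideal.span {a} * Q ^ n) ≤ Ideal.span {a} * Q ^ (n + 1) := by
      rw [mul_left_comm, pow_succ' Q n]
      refine Ideal.mul_mono_right (Ideal.mul_mono_left ?_)
      rw [hQ']
      exact le_sup_right
    rw [h1, ← sup_assoc, sup_eq_left.2 h2, Ideal.span_singleton_mul_span_singleton, ← pow_succ']

lemma span_pair_pow_succ_smul_top (a b : R) (n : ℕ) :
    (Ideal.span {a, b} ^ (n + 1) • ⊤ : Submodule R M) =
      a • (Ideal.span {a, b} ^ n • ⊤ : Submodule R M) ⊔ b ^ (n + 1) • (⊤ : Submodule R M) := by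
  rw [span_pair_pow_succ, Submodule.sup_smul, mul_smul, Submodule.ideal_span_singleton_smul,
    Submodule.ideal_span_singleton_smul]

/-- The Hilbert-Samuel function of a regular sequence of length two. -/
lemma length_quotient_span_pair_pow (ha : ∀ x : M, a • x = 0 → x = 0)
    (hb : ∀ x y : M, b • x = a • y → ∃ z, x = a • z) (n : ℕ) :
    Module.length R (M ⧸ (Ideal.span {a, b} ^ n • ⊤ : Submodule R M)) =
      (n + 1).choose 2 * Module.length R (M ⧸ (Ideal.span {a, b} • ⊤ : Submodule R M)) := by
  induction n with
  | zero =>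
    rw [pow_zero, Ideal.one_eq_top, Submodule.top_smul]
    rw [Nat.choose_eq_zero_of_lt (by norm_num), Nat.cast_zero, zero_mul]
    rw [Module.length_eq_zero_iff]
    exact Submodule.Quotient.subsingleton_iff.2 rfl
  | succ n ih =>
    -- The colon of `Q^(n+1) M` by `a` is `Q^n M`, and the remaining quotient by `aM + b^(n+1) M`
    -- contributes `n + 1` copies of `ℓ(M/QM)`.
    rw [length_quotient_eq_add_of_smul (c := a) (P := Ideal.span {a, b} ^ n • ⊤), ih]
    · have e : (Ideal.span {a, b} ^ (n + 1) • ⊤ ⊔ a • ⊤ : Submodule R M) =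
          a • ⊤ ⊔ b ^ (n + 1) • ⊤ := by
        rw [span_pair_pow_succ_smul_top, sup_right_comm, sup_eq_right.2 (smul_mono_right a le_top)]
      have e1 : (Ideal.span {a, b} • ⊤ : Submodule R M) = a • ⊤ ⊔ b • ⊤ := by
        rw [Ideal.span_insert, Submodule.sup_smul, Submodule.ideal_span_singleton_smul,
          Submodule.ideal_span_singleton_smul]
      rw [e, length_quotient_sup_pow hb, e1, Nat.choose_succ_succ' (n + 1) 1, Nat.choose_one_right]
      push_cast
      ring
    · intro x
      rw [span_pair_pow_succ_smul_top]
      constructor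
      · intro hx
        obtain ⟨u, hu, v, hv, h⟩ := Submodule.mem_sup.1 hx
        obtain ⟨y, hy, rfl⟩ := (Submodule.mem_smul_pointwise_iff_exists _ _ _).1 hu
        obtain ⟨z, -, rfl⟩ := (Submodule.mem_smul_pointwise_iff_exists _ _ _).1 hv
        have h1 : b ^ (n + 1) • z = a • (x - y) := by
          rw [smul_sub, ← h]
          abel
        -- From `a x = a y + b^(n+1) z` with `y ∈ Q^n M`, regularity gives `z = a w`; cancelling `a`
        -- yields `x = y + b^(n+1) w`.
        obtain ⟨w, rfl⟩ := exists_eq_smul_of_pow_smul hb _ _ _ h1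
        have h2 : x - y = b ^ (n + 1) • w := by
          rw [← sub_eq_zero]
          apply ha
          rw [smul_sub, ← h1, smul_comm, sub_self]
        have h3 : b ^ (n + 1) • w ∈ (Ideal.span {a, b} ^ n • ⊤ : Submodule R M) := by
          rw [pow_succ, mul_smul]
          exact Submodule.smul_mem_smul (Ideal.pow_mem_pow (Ideal.subset_span (by simp)) n) trivial
        rw [(sub_eq_iff_eq_add.1 h2)]
        exact add_mem h3 hy
      · intro hx
        exact Submodule.mem_sup_left (Submodule.smul_mem_pointwise_smul _ _ _ hx)

end ModuleLength

/-! ### The extension `R ⊆ S` -/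

lemma isWeaklyRegular_pair_iff {R M : Type*} [CommRing R] [AddCommGroup M] [Module R M] {a b : R} :
    RingTheory.Sequence.IsWeaklyRegular M [a, b] ↔
      (∀ x : M, a • x = 0 → x = 0) ∧ ∀ x y : M, b • x = a • y → ∃ z, x = a • z := by
  rw [RingTheory.Sequence.isWeaklyRegular_cons_iff, RingTheory.Sequence.isWeaklyRegular_singleton_iff,
    isSMulRegular_iff_right_eq_zero_of_smul, isSMulRegular_iff_right_eq_zero_of_smul]
  refine and_congr_right fun _ => ⟨fun h x y hxy => ?_, fun h x hx => ?_⟩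
  · have h1 := h (Submodule.Quotient.mk x) (by
      rw [← Submodule.Quotient.mk_smul, Submodule.Quotient.mk_eq_zero, hxy]
      exact Submodule.smul_mem_pointwise_smul _ _ _ trivial)
    rw [Submodule.Quotient.mk_eq_zero, Submodule.mem_smul_pointwise_iff_exists] at h1
    obtain ⟨z, -, hz⟩ := h1
    exact ⟨z, hz.symm⟩
  · induction x using Submodule.Quotient.induction_on with
    | _ x =>
    rw [← Submodule.Quotient.mk_smul, Submodule.Quotient.mk_eq_zero,
      Submodule.mem_smul_pointwise_iff_exists] at hx
    obtain ⟨y, -, hy⟩ := hx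
    obtain ⟨z, rfl⟩ := h x y hy.symm
    rw [Submodule.Quotient.mk_eq_zero]
    exact Submodule.smul_mem_pointwise_smul _ _ _ trivial

lemma mono_ne_zero {k : Type*} [Field k] {σ : Type*} {H : AddSubmonoid (σ →₀ ℕ)} {R : Type*}
    [CommRing R] [Algebra R (MvPowerSeries σ k)] [IsMonoidSeries k H R] (h : H) :
    mono k H R h ≠ 0 := by
  intro e
  have h1 := congrArg (fun r => coeff (h : σ →₀ ℕ) (algebraMap R (MvPowerSeries σ k) r)) e
  simp at h1

section Extension

variable {k : Type*} [Field k] {R S : Type*} [CommRing R] [CommRing S]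
  [Algebra R (MvPowerSeries (Fin 2) k)] [Algebra S (MvPowerSeries (Fin 2) k)]
  [Algebra R S] [IsScalarTower R S (MvPowerSeries (Fin 2) k)]

variable (k R S) in
-- `S` is generated by 1, `X^3 Y^2` and `X^2 Y^3`: the other missing exponents are (3,2) + (0,5) and
-- (2,3) + (5,0).
lemma finite_extension [IsMonoidSeries k monoidR R] [IsMonoidSeries k monoidS S] :
    Module.Finite R S := by
  refine finite_of_add_eq k monoidS S (G := monoidR) (F := {0, expo 3 2, expo 2 3}) (by simp) ?_
  ext m
  rw [Set.mem_add]
  constructor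
  · rintro ⟨a, ha, b, hb, rfl⟩
    refine monoidS.add_mem ?_ (monoidR_le_monoidS hb)
    rcases ha with rfl | rfl | rfl
    · exact monoidS.zero_mem
    · exact expo_mem_monoidS (by norm_num)
    · exact expo_mem_monoidS (by norm_num)
  · intro hm
    by_cases h : m ∈ monoidR
    · exact ⟨0, by simp, m, h, zero_add m⟩
    have h1 : 5 ∣ m 0 + m 1 := mem_monoidS_iff.1 hm
    rw [mem_monoidR_iff] at h
    have h2 : (m 0 = 3 ∧ m 1 = 2) ∨ (m 0 = 2 ∧ m 1 = 3) ∨ (m 0 = 3 ∧ m 1 = 7) ∨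
      (m 0 = 7 ∧ m 1 = 3) := by tauto
    rcases h2 with ⟨h2, h3⟩ | ⟨h2, h3⟩ | ⟨h2, h3⟩ | ⟨h2, h3⟩
    · exact ⟨expo 3 2, by simp, 0, monoidR.zero_mem, exponent_ext (by simp [h2]) (by simp [h3])⟩
    · exact ⟨expo 2 3, by simp, 0, monoidR.zero_mem, exponent_ext (by simp [h2]) (by simp [h3])⟩
    · exact ⟨expo 3 2, by simp, expo 0 5, expo_mem_monoidR_right (dvd_refl 5),
        exponent_ext (by simp [h2]) (by simp [h3])⟩
    · exact ⟨expo 2 3, by simp, expo 5 0, expo_mem_monoidR_left (dvd_refl 5),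
        exponent_ext (by simp [h2]) (by simp [h3])⟩

variable (k) in
lemma algebraMap_extension (r : R) :
    algebraMap S (MvPowerSeries (Fin 2) k) (algebraMap R S r) =
      algebraMap R (MvPowerSeries (Fin 2) k) r :=
  (IsScalarTower.algebraMap_apply R S _ r).symm

variable (k R S) in
lemma algebraMap_extension_injective [IsMonoidSeries k monoidR R] :
    Function.Injective (algebraMap R S) := fun a b h =>
  IsMonoidSeries.injective (k := k) (H := monoidR) (by
    rw [← algebraMap_extension k (S := S) a, h, algebraMap_extension k])

lemma map_smul_extension (r : R) (s : S) :
    algebraMap S (MvPowerSeries (Fin 2) k) (r • s) =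
      algebraMap R (MvPowerSeries (Fin 2) k) r * algebraMap S (MvPowerSeries (Fin 2) k) s := by
  rw [Algebra.smul_def, map_mul, algebraMap_extension]

variable (k R) in
lemma mem_range_algebraMap_iff [IsMonoidSeries k monoidR R] [IsMonoidSeries k monoidS S]
    {s : S} : s ∈ Set.range (algebraMap R S) ↔
    ∀ n, coeff n (algebraMap S (MvPowerSeries (Fin 2) k) s) ≠ 0 → n ∈ monoidR := by
  constructor
  · rintro ⟨r, rfl⟩ n hn
    rw [algebraMap_extension] at hn
    exact mem_of_coeff_ne_zero k monoidR r hn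
  · intro h
    obtain ⟨r, hr⟩ := exists_eq monoidR R h
    exact ⟨r, IsMonoidSeries.injective (k := k) (H := monoidS) (by rw [algebraMap_extension, hr])⟩

variable (k) in
lemma smul_eq_zero_extension [IsMonoidSeries k monoidR R] [IsMonoidSeries k monoidS S]
    {a : R} (ha : a ≠ 0) {s : S} (h : a • s = 0) : s = 0 := by
  have := isDomain (k := k) (H := monoidS) (R := S) inferInstance
  rw [Algebra.smul_def, mul_eq_zero] at h
  refine h.resolve_left fun h => ha (algebraMap_extension_injective k R S ?_)
  rw [h, map_zero]

variable (k R S) in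
lemma length_quotient_range [IsMonoidSeries k monoidR R] [IsMonoidSeries k monoidS S]
    [IsLocalRing R] :
    Module.length R (S ⧸ LinearMap.range (Algebra.linearMap R S)) = (4 : ℕ) := by
  let φ : S →ₗ[R] MvPowerSeries (Fin 2) k :=
    (IsScalarTower.toAlgHom R S (MvPowerSeries (Fin 2) k)).toLinearMap
  have hφ : ∀ s, φ s = algebraMap S _ s := fun s => rfl
  have hB : ∀ h ∈ monoidR, ∀ b ∈ (monoidS : Set (Fin 2 →₀ ℕ)), h + b ∈ (monoidS : Set _) :=
    fun h hh b hb => monoidS.add_mem (monoidR_le_monoidS hh) hb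
  have hA : ∀ h ∈ monoidR, ∀ b ∈ (monoidR : Set (Fin 2 →₀ ℕ)), h + b ∈ (monoidR : Set _) :=
    fun h hh b hb => monoidR.add_mem hh hb
  have hr : LinearMap.range φ = supportedOn k monoidR R hB := by
    ext f
    rw [LinearMap.mem_range, mem_supportedOn]
    constructor
    · rintro ⟨s, rfl⟩ n hn
      exact mem_of_coeff_ne_zero k monoidS s hn
    · exact fun h => exists_eq monoidS S h
  have hc : ((monoidS : Set (Fin 2 →₀ ℕ)) \ (monoidR : Set (Fin 2 →₀ ℕ))).encard = (4 : ℕ) := by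
    rw [← encard_missing, ← encard_setOf_exponent]
    congr 1
    ext m
    simp only [Set.mem_sdiff, SetLike.mem_coe, mem_monoidR_iff', mem_monoidS_iff, Set.mem_ofPred_eq]
    constructor
    · tauto
    · intro h
      refine ⟨?_, fun h' => h'.2 h⟩
      simp only [missing, Finset.mem_insert, Finset.mem_singleton, Prod.mk.injEq] at h
      omega
  have h := length_quotient_supportedOn φ hB hr hA monoidR_le_monoidS 4 hc
  have e : (supportedOn k monoidR R hA).comap φ = LinearMap.range (Algebra.linearMap R S) := by
    ext s
    rw [Submodule.mem_comap, mem_supportedOn]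
    exact (mem_range_algebraMap_iff k R).symm
  rwa [e] at h

/-- `X ^ N, Y ^ N` is a regular sequence on `S`. -/
lemma exists_eq_smul_of_mono_smul [IsMonoidSeries k monoidR R] [IsMonoidSeries k monoidS S]
    {N : ℕ} (hN : 5 ∣ N) {u v : S}
    (h : mono k monoidR R ⟨_, expo_mem_monoidR_left hN⟩ • v =
      mono k monoidR R ⟨_, expo_mem_monoidR_right hN⟩ • u) :
    ∃ w : S, u = mono k monoidR R ⟨_, expo_mem_monoidR_left hN⟩ • w := by
  classical
  have h' := congrArg (algebraMap S (MvPowerSeries (Fin 2) k)) h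
  rw [map_smul_extension, map_smul_extension, map_mono, map_mono] at h'
  simp only at h'
  set f := algebraMap S (MvPowerSeries (Fin 2) k) u with hf
  -- The formal quotient of `u` by `X ^ N`; since `5 ∣ N`, the shift preserves the congruence that
  -- defines the monoid of `S`.
  let g : MvPowerSeries (Fin 2) k := fun n => coeff (expo N 0 + n) f
  have hg : ∀ n, coeff n g = coeff (expo N 0 + n) f := fun n => rfl
  obtain ⟨w, hw⟩ := exists_eq monoidS S (f := g) (fun n hn => by
    have := mem_monoidS_iff.1 (mem_of_coeff_ne_zero k monoidS u (hg n ▸ hn))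
    simp only [Finsupp.add_apply, expo_apply_zero, expo_apply_one] at this
    rw [mem_monoidS_iff]
    omega)
  refine ⟨w, IsMonoidSeries.injective (k := k) (H := monoidS) ?_⟩
  rw [map_smul_extension, map_mono, hw, ← hf]
  ext n
  rw [coeff_monomial_mul]
  split_ifs with hn
  · rw [hg, one_mul, add_tsub_cancel_of_le hn]
  -- An exponent of `u` not divisible by `X ^ N` would stay so after multiplication by `Y ^ N`,
  -- contradicting the equality with a multiple of `X ^ N`.
  · by_contra hne
    have h2 : coeff (expo 0 N + n) (monomial (expo 0 N) (1 : k) * f) ≠ 0 := by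
      rwa [coeff_add_monomial_mul, one_mul]
    rw [← h', coeff_monomial_mul] at h2
    split_ifs at h2 with h3
    · apply hn
      intro i
      fin_cases i
      · simpa using h3 0
      · simp
    · exact h2 rfl

variable (k) in
/-- Every system of parameters of `R` is a regular sequence on `S`. -/
lemma regular_of_radical_eq [IsMonoidSeries k monoidR R] [IsMonoidSeries k monoidS S]
    [IsLocalRing R] {a b : R}
    (h : (Ideal.span {a, b}).radical = IsLocalRing.maximalIdeal R) :
    (∀ s : S, a • s = 0 → s = 0) ∧ ∀ s t : S, b • s = a • t → ∃ w, s = a • w := by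
  have key : ∀ r ∈ IsLocalRing.maximalIdeal R, ∃ n : ℕ, r ^ n ∈ Ideal.span {a, b} := by
    intro r hr
    rwa [← h] at hr
  obtain ⟨m, hx⟩ := key _ (mono_mem_maximalIdeal (k := k)
    (h := ⟨_, expo_mem_monoidR_left (dvd_refl 5)⟩)
    (fun e => expo_ne_zero (Or.inl (by norm_num)) (congrArg Subtype.val e)))
  obtain ⟨n, hy⟩ := key _ (mono_mem_maximalIdeal (k := k)
    (h := ⟨_, expo_mem_monoidR_right (dvd_refl 5)⟩)
    (fun e => expo_ne_zero (Or.inr (by norm_num)) (congrArg Subtype.val e)))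
  -- The exponent `m + n` serves both variables, so that `x = X ^ M` and `y = Y ^ M` lie in `(a,
  -- b)`.
  set M := 5 * (m + n) with hM
  have hMd : 5 ∣ M := ⟨_, rfl⟩
  have hX : mono k monoidR R ⟨_, expo_mem_monoidR_left hMd⟩ =
      mono k monoidR R ⟨_, expo_mem_monoidR_left (dvd_refl 5)⟩ ^ (m + n) := by
    rw [mono_pow]
    congr 1
    exact Subtype.ext (exponent_ext (by simp [hM, mul_comm]) (by simp))
  have hY : mono k monoidR R ⟨_, expo_mem_monoidR_right hMd⟩ =
      mono k monoidR R ⟨_, expo_mem_monoidR_right (dvd_refl 5)⟩ ^ (m + n) := by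
    rw [mono_pow]
    congr 1
    exact Subtype.ext (exponent_ext (by simp) (by simp [hM, mul_comm]))
  set x := mono k monoidR R ⟨_, expo_mem_monoidR_left hMd⟩ with hxdef
  set y := mono k monoidR R ⟨_, expo_mem_monoidR_right hMd⟩ with hydef
  have hxQ : x ∈ Ideal.span {a, b} := by
    rw [hX, pow_add]
    exact Ideal.mul_mem_right _ _ hx
  have hyQ : y ∈ Ideal.span {a, b} := by
    rw [hY, pow_add]
    exact Ideal.mul_mem_left _ _ hy
  obtain ⟨c, d, hcd⟩ := Ideal.mem_span_pair.1 hxQ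
  obtain ⟨c', d', hcd'⟩ := Ideal.mem_span_pair.1 hyQ
  have hx0 : x ≠ 0 := mono_ne_zero _
  -- If `a = 0`, then `x = d b` and `y = d' b`, so `x d' = y d` and regularity gives `d = x w = d b
  -- w`. Hence `b w = 1`, although `b` is in the maximal ideal.
  have ha : a ≠ 0 := by
    rintro rfl
    obtain ⟨w, hw⟩ := exists_eq_smul_of_mono_smul (k := k) (R := R) (S := S) hMd
      (u := algebraMap R S d) (v := algebraMap R S d') (by
        rw [← hxdef, ← hydef, Algebra.smul_def, Algebra.smul_def, ← map_mul, ← map_mul, ← hcd,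
          ← hcd']
        congr 1
        ring)
    have hd : d ≠ 0 := by
      rintro rfl
      exact hx0 (by rw [← hcd]; ring)
    have h1 : b • w = 1 := by
      rw [← sub_eq_zero]
      apply smul_eq_zero_extension k hd
      rw [smul_sub, sub_eq_zero, smul_smul, Algebra.smul_def d 1, mul_one, hw, ← hxdef, ← hcd, mul_zero,
        zero_add]
    have hb : b ∈ IsLocalRing.maximalIdeal R := h ▸ Ideal.le_radical (Ideal.subset_span (by simp))
    rw [mem_maximalIdeal_iff (k := k) (H := monoidR) inferInstance] at hb
    have h2 := congrArg (fun s => coeff 0 (algebraMap S (MvPowerSeries (Fin 2) k) s)) h1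
    simp only [map_smul_extension, map_one, coeff_zero_eq_constantCoeff, map_mul] at h2
    rw [coeff_zero_eq_constantCoeff_apply] at hb
    rw [hb, zero_mul] at h2
    exact zero_ne_one h2
  refine ⟨fun s => smul_eq_zero_extension k ha, fun s t hst => ?_⟩
  -- The relation is transferred to `x, y`: cancelling `a` gives `x (c's + d't) = y (cs + dt)`, so
  -- `cs + dt = x w`. Then `x s = a x w`, and `x` cancels.
  have hxs : x • s = a • (c • s + d • t) := by
    rw [← hcd, add_smul, mul_smul, mul_smul, hst, smul_add, smul_comm a c, smul_comm a d]
  have hys : y • s = a • (c' • s + d' • t) := by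
    rw [← hcd', add_smul, mul_smul, mul_smul, hst, smul_add, smul_comm a c', smul_comm a d']
  obtain ⟨w, hw⟩ := exists_eq_smul_of_mono_smul (k := k) (R := R) hMd
    (u := c • s + d • t) (v := c' • s + d' • t) (by
      rw [← hxdef, ← hydef, ← sub_eq_zero]
      apply smul_eq_zero_extension k ha
      rw [smul_sub, smul_comm a x, smul_comm a y, ← hxs, ← hys, smul_comm x y, sub_self])
  refine ⟨w, ?_⟩
  rw [← sub_eq_zero]
  apply smul_eq_zero_extension k hx0
  rw [smul_sub, hxs, hw, smul_comm, sub_self]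

end Extension

/-! ### Lengths modulo parameter ideals -/

/-- A quadratic polynomial that eventually dominates `L * (n + 2).choose 2 - C` has leading
coefficient at least `L`. -/
lemma le_of_eventually_choose_le {L e₀ e₁ e₂ C : ℤ}
    (h : ∀ᶠ n : ℕ in Filter.atTop,
      L * ((n + 2).choose 2 : ℤ) ≤ e₀ * ((n + 2).choose 2 : ℤ) - e₁ * (n + 1) + e₂ + C) :
    L ≤ e₀ := by
  -- For such `n` the lower-order terms are at most `(|e₁| + |e₂| + |C|) (n + 1) ≤ n (n + 1) / 2`,
  -- which is less than `(n + 2).choose 2`.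
  obtain ⟨n, hn, hn'⟩ :=
    (h.and (Filter.eventually_ge_atTop (2 * (e₁.natAbs + e₂.natAbs + C.natAbs)))).exists
  by_contra! hlt
  have h2 : 2 * ((n + 2).choose 2 : ℤ) = (n + 2) * (n + 1) := by
    have := Nat.choose_two_right (n + 2)
    have h3 := Nat.even_mul_pred_self (n + 2)
    obtain ⟨r, hr⟩ := h3
    have h4 : n + 2 - 1 = n + 1 := rfl
    rw [hr] at this
    rw [h4] at hr
    have : (n + 2).choose 2 = r := by omega
    rw [this]
    have hr' : (((n + 2) * (n + 1) : ℕ) : ℤ) = r + r := by exact_mod_cast hr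
    push_cast at hr'
    linarith
  have h5 : ((n + 2).choose 2 : ℤ) ≤ (L - e₀) * ((n + 2).choose 2 : ℤ) :=
    le_mul_of_one_le_left (by positivity) (by linarith)
  have h1 : -e₁ * (n + 1 : ℤ) ≤ e₁.natAbs * (n + 1 : ℤ) :=
    mul_le_mul_of_nonneg_right (by omega) (by positivity)
  have h6 : (e₂ + C : ℤ) ≤ (e₂.natAbs + C.natAbs : ℤ) * (n + 1 : ℤ) := by
    have : (e₂ + C : ℤ) ≤ (e₂.natAbs + C.natAbs : ℤ) := by omega
    exact this.trans (le_mul_of_one_le_right (by positivity) (by linarith))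
  have h7 : (2 * (e₁.natAbs + e₂.natAbs + C.natAbs) : ℤ) ≤ n := by exact_mod_cast hn'
  have h8 : (2 * (e₁.natAbs + e₂.natAbs + C.natAbs) : ℤ) * (n + 1 : ℤ) ≤ n * (n + 1 : ℤ) :=
    mul_le_mul_of_nonneg_right h7 (by positivity)
  linarith

/-! ### Comparing colengths in `R` and `S`: the generalized Cohen-Macaulay bound. -/

section Extension

variable {k : Type*} [Field k] {R S : Type*} [CommRing R] [CommRing S]
  [Algebra R (MvPowerSeries (Fin 2) k)] [Algebra S (MvPowerSeries (Fin 2) k)]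
  [Algebra R S] [IsScalarTower R S (MvPowerSeries (Fin 2) k)]

section

variable [IsLocalRing R]

variable (k S) in
lemma length_quotient_map_extension [IsMonoidSeries k monoidR R] [IsMonoidSeries k monoidS S]
    (I : Ideal R) :
    Module.length R (S ⧸ Submodule.map (Algebra.linearMap R S) I) =
      Module.length R (R ⧸ I) + (4 : ℕ) := by
  rw [length_quotient_map_eq_add (Algebra.linearMap R S) (algebraMap_extension_injective k R S),
    length_quotient_range k R S]

lemma map_linearMap_eq_smul {R S : Type*} [CommRing R] [CommRing S] [Algebra R S]
    (I : Ideal R) :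
    Submodule.map (Algebra.linearMap R S) I = I • LinearMap.range (Algebra.linearMap R S) := by
  rw [LinearMap.range_eq_map, ← Submodule.map_smul'', smul_eq_mul, Ideal.mul_top]

variable (k S) in
-- Inside `S`, with `N` the copy of `R`, passing from `aN + bN` to `aN + bS` and then to `aS + bS`
-- costs at most `ℓ(S/N) = 4` each time. One of these two fours cancels against `ℓ(S/(aN + bN)) =
-- ℓ(R/(a, b)) + 4`.
lemma length_quotient_pair_le [IsMonoidSeries k monoidR R] [IsMonoidSeries k monoidS S] (a b : R) :
    Module.length R (R ⧸ Ideal.span {a, b}) ≤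
      Module.length R (S ⧸ (Ideal.span {a, b} • ⊤ : Submodule R S)) + (4 : ℕ) := by
  set N := LinearMap.range (Algebra.linearMap R S) with hN
  have h1 := length_quotient_map_extension k S (Ideal.span {a, b})
  have h2 := length_quotient_sup_smul_le b (a • N) N
  have h3 := length_quotient_sup_smul_le a (b • ⊤) N
  rw [map_linearMap_eq_smul, Ideal.span_insert, Submodule.sup_smul,
    Submodule.ideal_span_singleton_smul, Submodule.ideal_span_singleton_smul] at h1
  rw [sup_comm, sup_comm (b • ⊤)] at h3
  rw [length_quotient_range k R S] at h2 h3
  rw [Ideal.span_insert, Submodule.sup_smul,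
    Submodule.ideal_span_singleton_smul, Submodule.ideal_span_singleton_smul]
  rw [h1] at h2
  refine (ENat.add_le_add_iff_right (ENat.natCast_ne_top 4)).1 (h2.trans ?_)
  rw [add_comm]
  gcongr
  rwa [add_comm]

/-- The left side is `ℓ(S/Q^(n+1)S)` since `a, b` is regular on `S`; the right side is the length of
`S` modulo the smaller module `Q^(n+1)`. Asymptotically this gives `ℓ(S/QS) ≤ e_0(Q)`. -/
lemma choose_mul_length_le [IsMonoidSeries k monoidR R] [IsMonoidSeries k monoidS S] {a b : R}
    (h : (Ideal.span {a, b}).radical = IsLocalRing.maximalIdeal R) (n : ℕ) :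
    (n + 2).choose 2 * Module.length R (S ⧸ (Ideal.span {a, b} • ⊤ : Submodule R S)) ≤
      Module.length R (R ⧸ Ideal.span {a, b} ^ (n + 1)) + (4 : ℕ) := by
  obtain ⟨ha, hb⟩ := regular_of_radical_eq k (S := S) h
  rw [← length_quotient_span_pair_pow ha hb (n + 1), ← length_quotient_map_extension k S,
    map_linearMap_eq_smul]
  exact Module.length_le_of_surjective (Submodule.factor (Submodule.smul_mono le_rfl le_top))
    (Submodule.factor_surjective _)

variable (k R S) in
lemma isGeneralizedCohenMacaulay [hR : IsMonoidSeries k monoidR R] [IsMonoidSeries k monoidS S] :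
    IsGeneralizedCohenMacaulay R := by
  refine ⟨4, fun Q hQ d e l hd he hl => ?_⟩
  have h2 := ringKrullDim_of_monoidR hR
  obtain rfl : d = 2 := by
    rw [h2] at hd
    exact_mod_cast hd.symm
  obtain ⟨d, hd', x, rfl, hrad⟩ := hQ
  obtain rfl : d = 2 := by
    rw [h2] at hd'
    exact_mod_cast hd'.symm
  have hQ : Ideal.span (Set.range x) = Ideal.span {x 0, x 1} := by
    congr 1
    ext y
    simp [Fin.exists_fin_two, eq_comm]
  rw [hQ] at hrad hl he
  have hle := length_quotient_pair_le k S (x 0) (x 1)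
  have hmul := choose_mul_length_le (k := k) (S := S) hrad
  generalize Module.length R (S ⧸ (Ideal.span {x 0, x 1} • ⊤ : Submodule R S)) = L at hle hmul
  -- The Hilbert coefficients exist only if some `R/Q^(n+1)` has finite length, and this bounds `L`.
  have hL : L ≠ ⊤ := by
    rintro rfl
    obtain ⟨n, m, hm, -⟩ := he.exists
    have := hmul n
    simp only at hm
    rw [hm, ENat.mul_top (by exact_mod_cast (Nat.choose_pos (by omega)).ne')] at this
    exact ENat.natCast_ne_top (m + 4) (top_le_iff.1 (by exact_mod_cast this))
  lift L to ℕ using hL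
  rw [hl] at hle
  have hle' : l ≤ L + 4 := by exact_mod_cast hle
  have : (L : ℤ) ≤ e 0 := by
    refine le_of_eventually_choose_le (e₁ := e 1) (e₂ := e 2) (C := 4) (he.mono ?_)
    rintro n ⟨m, hm, hm'⟩
    have := hmul n
    simp only at hm
    rw [hm] at this
    have h3 : (n + 2).choose 2 * L ≤ m + 4 := by exact_mod_cast this
    have h4 : ((n + 2).choose 2 * L : ℤ) ≤ m + 4 := by exact_mod_cast h3
    rw [hm', Fin.sum_univ_three] at h4
    simp at h4
    linarith
  omega

end

end Extension

/-! ### Serre's condition -/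

lemma supportDim_localizedModule_self {R : Type*} [CommRing R] (P : Ideal R) [P.IsPrime] :
    Module.supportDim (Localization.AtPrime P) (LocalizedModule P.primeCompl R) = P.height := by
  let e := LinearEquiv.extendScalarsOfIsLocalization P.primeCompl (Localization.AtPrime P)
    (IsLocalizedModule.linearEquiv P.primeCompl (LocalizedModule.mkLinearMap P.primeCompl R)
      (Algebra.linearMap R (Localization.AtPrime P)))
  rw [Module.supportDim_eq_of_equiv e, Module.supportDim_self_eq_ringKrullDim,
    IsLocalization.AtPrime.ringKrullDim_eq_height P]

lemma supportDim_localizedModule_le {R : Type*} [CommRing R] (M : Type*) [AddCommGroup M]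
    [Module R M] (P : Ideal R) [P.IsPrime] :
    Module.supportDim (Localization.AtPrime P) (LocalizedModule P.primeCompl M) ≤ P.height := by
  rw [← IsLocalization.AtPrime.ringKrullDim_eq_height P (Localization.AtPrime P)]
  exact Module.supportDim_le_ringKrullDim _ _

lemma height_maximalIdeal_eq_two {R : Type*} [CommRing R] [IsLocalRing R]
    (hdim : ringKrullDim R = 2) : (IsLocalRing.maximalIdeal R).height = 2 :=
  WithBot.coe_injective (IsLocalRing.maximalIdeal_height_eq_ringKrullDim.trans hdim)

/-- Over a two-dimensional Noetherian local domain, a finite torsion-free module is `(S_2)` if some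
elements of the maximal ideal form a regular sequence of length two on it. -/
lemma satisfiesSerre_two_of_regular {R : Type*} [CommRing R] [IsDomain R] [IsLocalRing R]
    [IsNoetherianRing R] (hdim : ringKrullDim R = 2) {M : Type*} [AddCommGroup M] [Module R M]
    [Module.Finite R M] (htf : ∀ r : R, r ≠ 0 → ∀ x : M, r • x = 0 → x = 0) {a b : R}
    (ha : a ∈ IsLocalRing.maximalIdeal R) (hb : b ∈ IsLocalRing.maximalIdeal R)
    (hreg : RingTheory.Sequence.IsWeaklyRegular M [a, b]) : SatisfiesSerre R 2 M := by
  intro P _ n hn h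
  have hnon : Nontrivial (LocalizedModule P.primeCompl M) := by
    rw [← Module.supportDim_ne_bot_iff_nontrivial (Localization.AtPrime P)]
    intro h0
    rw [h0] at h
    exact absurd h (by simp)
  have hht : (n : ℕ∞) ≤ P.height := by
    exact_mod_cast h.trans (supportDim_localizedModule_le M P)
  -- Weak regularity over `R` survives localization, and on a nontrivial finite module elements of
  -- `P` then form a regular sequence.
  suffices ∃ rs : List R, rs.length = n ∧ (∀ r ∈ rs, r ∈ P) ∧
      RingTheory.Sequence.IsWeaklyRegular M rs by
    obtain ⟨rs, hlen, hmem, hreg⟩ := this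
    refine ⟨rs.map (algebraMap R (Localization.AtPrime P)), by simpa using hlen, ?_,
      hreg.isRegular_of_isLocalizedModule_of_mem (Localization.AtPrime P) P
        (LocalizedModule.mkLinearMap P.primeCompl M) hmem⟩
    intro r hr
    obtain ⟨r, hr', rfl⟩ := List.mem_map.1 hr
    exact (IsLocalization.AtPrime.to_map_mem_maximal_iff _ P r).2 (hmem r hr')
  -- Length one: any nonzero element of `P` is regular, by torsion-freeness. Length two: `P` has
  -- height at least two, so it is the maximal ideal and contains `a, b`.
  interval_cases n
  · exact ⟨[], rfl, by simp, RingTheory.Sequence.IsWeaklyRegular.nil R M⟩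
  · have hP : P ≠ ⊥ := by
      rintro rfl
      rw [Ideal.height_bot] at hht
      exact absurd hht (by norm_num)
    obtain ⟨r, hr, hr0⟩ := Submodule.exists_mem_ne_zero_of_ne_bot hP
    refine ⟨[r], rfl, by simpa using hr, ?_⟩
    rw [RingTheory.Sequence.isWeaklyRegular_singleton_iff, isSMulRegular_iff_right_eq_zero_of_smul]
    exact htf r hr0
  · have hP : P = IsLocalRing.maximalIdeal R :=
      Ideal.eq_of_le_of_height_le P (IsLocalRing.le_maximalIdeal Ideal.IsPrime.ne_top')
        (by rw [height_maximalIdeal_eq_two hdim]; exact_mod_cast hht)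
    exact ⟨[a, b], rfl, by simpa [hP] using And.intro ha hb, hreg⟩

/-- A local ring of dimension at least two that is `(S_2)` has a regular sequence of length two. -/
lemma exists_regular_of_satisfiesSerre_two {R : Type*} [CommRing R] [IsLocalRing R]
    (hdim : 2 ≤ ringKrullDim R) (h : SatisfiesSerre R 2 R) :
    ∃ a ∈ IsLocalRing.maximalIdeal R, ∃ b ∈ IsLocalRing.maximalIdeal R,
      RingTheory.Sequence.IsWeaklyRegular R [a, b] := by
  set P := IsLocalRing.maximalIdeal R with hP
  obtain ⟨rs, hlen, hmem, hreg⟩ := h P 2 le_rfl (by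
    rw [supportDim_localizedModule_self, IsLocalRing.maximalIdeal_height_eq_ringKrullDim]
    exact hdim)
  -- Localizing a local ring at its maximal ideal changes nothing, so the regular sequence descends
  -- to `R` itself.
  have hunits : P.primeCompl ≤ IsUnit.submonoid R := fun r hr =>
    IsLocalRing.notMem_maximalIdeal.1 hr
  let e := IsLocalization.atUnits R P.primeCompl (S := Localization.AtPrime P) hunits
  have hsurj : ∀ r' : Localization.AtPrime P, ∃ r : R, algebraMap R _ r = r' := fun r' =>
    ⟨e.symm r', by rw [← AlgEquiv.commutes e.symm.symm]; simp⟩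
  obtain ⟨a', b', rfl⟩ := List.length_eq_two.1 hlen
  obtain ⟨a, rfl⟩ := hsurj a'
  obtain ⟨b, rfl⟩ := hsurj b'
  have := IsLocalization.isLocalization_of_algEquiv P.primeCompl e.symm
  have : IsLocalizedModule P.primeCompl (LinearMap.id : R →ₗ[R] R) := isLocalizedModule_id _ _ R
  refine ⟨a, (IsLocalization.AtPrime.to_map_mem_maximal_iff _ P a).1 (hmem _ (by simp)),
    b, (IsLocalization.AtPrime.to_map_mem_maximal_iff _ P b).1 (hmem _ (by simp)), ?_⟩
  rw [(IsLocalizedModule.linearEquiv P.primeCompl (LinearMap.id : R →ₗ[R] R)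
    (LocalizedModule.mkLinearMap P.primeCompl R)).isWeaklyRegular_congr,
    ← RingTheory.Sequence.isWeaklyRegular_map_algebraMap_iff (Localization.AtPrime P)]
  exact hreg.1

/-! ### Failure of `(S_2)` for `R`, and `S` as the `S_2`-ification. -/

section Extension

variable {k : Type*} [Field k] {R S : Type*} [CommRing R] [CommRing S]
  [Algebra R (MvPowerSeries (Fin 2) k)] [Algebra S (MvPowerSeries (Fin 2) k)]
  [Algebra R S] [IsScalarTower R S (MvPowerSeries (Fin 2) k)]

variable (k S) in
-- The exponent (7,3) is maximal among the missing ones, so adding any nonzero exponent of `R` lands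
-- in the monoid of `R`: `X^7 Y^3` is a socle element of `S/R`.
lemma smul_mem_range_of_mem_maximalIdeal [IsMonoidSeries k monoidR R] [IsMonoidSeries k monoidS S]
    [IsLocalRing R] {a : R} (ha : a ∈ IsLocalRing.maximalIdeal R) :
    a • mono k monoidS S ⟨_, expo_mem_monoidS (a := 7) (b := 3) (by norm_num)⟩ ∈
      Set.range (algebraMap R S) := by
  rw [mem_range_algebraMap_iff k R]
  intro n hn
  rw [map_smul_extension, map_mono] at hn
  obtain ⟨i, j, rfl, hi, hj⟩ := exists_add_eq_of_coeff_mul_ne_zero hn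
  obtain rfl := eq_of_coeff_monomial_ne_zero hj
  have hi0 : i ≠ 0 := by
    rintro rfl
    exact hi ((mem_maximalIdeal_iff (k := k) (H := monoidR) inferInstance).1 ha)
  have hi1 : ¬ (i 0 = 0 ∧ i 1 = 0) := fun h => hi0 (exponent_ext h.1 h.2)
  have hiR := (mem_monoidR_iff.1 (mem_of_coeff_ne_zero k monoidR a hi)).1
  rw [mem_monoidR_iff]
  simp only [Finsupp.add_apply, expo_apply_zero, expo_apply_one]
  omega

variable (k R S) in
-- If `a, b` were regular on `R` and `s = X^7 Y^3`, then `as` and `bs` lie in `R` and `b (as) = a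
-- (bs)`. Regularity makes `as` a multiple of `a` in `R`, hence `s ∈ R`, which is false.
lemma not_satisfiesSerre_two [hR : IsMonoidSeries k monoidR R] [IsMonoidSeries k monoidS S]
    [IsLocalRing R] : ¬ SatisfiesSerre R 2 R := by
  intro h
  obtain ⟨a, ha, b, hb, hreg⟩ :=
    exists_regular_of_satisfiesSerre_two (ringKrullDim_of_monoidR hR).ge h
  rw [isWeaklyRegular_pair_iff] at hreg
  set s := mono k monoidS S ⟨_, expo_mem_monoidS (a := 7) (b := 3) (by norm_num)⟩ with hs
  obtain ⟨r₁, h₁⟩ := smul_mem_range_of_mem_maximalIdeal k S ha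
  obtain ⟨r₂, h₂⟩ := smul_mem_range_of_mem_maximalIdeal k S hb
  rw [← hs] at h₁ h₂
  obtain ⟨z, hz⟩ := hreg.2 r₁ r₂ (algebraMap_extension_injective k R S (by
    rw [smul_eq_mul, smul_eq_mul, map_mul, map_mul, h₁, h₂, ← Algebra.smul_def,
      ← Algebra.smul_def, smul_comm]))
  have ha0 : a ≠ 0 := by
    rintro rfl
    exact one_ne_zero (hreg.1 1 (zero_smul _ _))
  have hsz : s = algebraMap R S z := by
    rw [← sub_eq_zero]
    apply smul_eq_zero_extension k ha0
    rw [smul_sub, ← h₁, hz, smul_eq_mul, map_mul, Algebra.smul_def, sub_self]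
  have hmem := (mem_range_algebraMap_iff k R (s := s)).1 ⟨z, hsz.symm⟩ (expo 7 3) (by
    rw [hs, map_mono, coeff_monomial_same]
    exact one_ne_zero)
  rw [mem_monoidR_iff] at hmem
  simp at hmem

variable (k) in
-- Both coordinates of every missing exponent are at most 7, so such a monomial lies in the
-- conductor.
lemma smul_mem_range_of_le [IsMonoidSeries k monoidR R] [IsMonoidSeries k monoidS S]
    {h : monoidR} (hh : 8 ≤ (h : Fin 2 →₀ ℕ) 0 ∨ 8 ≤ (h : Fin 2 →₀ ℕ) 1) (s : S) :
    mono k monoidR R h • s ∈ Set.range (algebraMap R S) := by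
  rw [mem_range_algebraMap_iff k R]
  intro n hn
  rw [map_smul_extension, map_mono] at hn
  obtain ⟨i, j, rfl, hi, hj⟩ := exists_add_eq_of_coeff_mul_ne_zero hn
  obtain rfl := eq_of_coeff_monomial_ne_zero hi
  have h1 := mem_monoidS_iff.1 (mem_of_coeff_ne_zero k monoidS s hj)
  have h2 := (mem_monoidR_iff.1 h.2).1
  rw [mem_monoidR_iff]
  simp only [Finsupp.add_apply]
  omega

variable (k R S) in
lemma exists_algHom_fractionRing [hR : IsMonoidSeries k monoidR R]
    [hS : IsMonoidSeries k monoidS S] :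
    ∃ f : S →ₐ[R] FractionRing R, Function.Injective f := by
  have := hR.isDomain
  have := hS.isDomain
  have hinj : Function.Injective (algebraMap R (FractionRing S)) := by
    rw [IsScalarTower.algebraMap_eq R S (FractionRing S)]
    exact (IsFractionRing.injective S _).comp (algebraMap_extension_injective k R S)
  have : FaithfulSMul R (FractionRing S) := (faithfulSMul_iff_algebraMap_injective _ _).2 hinj
  -- A fraction `s / t` equals `X^10 s / X^10 t`, whose numerator and denominator lie in `R`.
  have : IsFractionRing R (FractionRing S) := by
    refine IsFractionRing.of_field _ _ fun z => ?_
    obtain ⟨s, t, ht, rfl⟩ := IsFractionRing.div_surjective (A := S) z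
    set x := mono k monoidR R ⟨_, expo_mem_monoidR_left (N := 10) (by norm_num)⟩ with hx
    obtain ⟨u, hu⟩ := smul_mem_range_of_le k (R := R) (S := S)
      (h := ⟨_, expo_mem_monoidR_left (N := 10) (by norm_num)⟩) (by simp) s
    obtain ⟨v, hv⟩ := smul_mem_range_of_le k (R := R) (S := S)
      (h := ⟨_, expo_mem_monoidR_left (N := 10) (by norm_num)⟩) (by simp) t
    refine ⟨u, v, ?_⟩
    have hx0 : algebraMap R (FractionRing S) x ≠ 0 := by
      rw [Ne, ← map_zero (algebraMap R (FractionRing S)), hinj.eq_iff]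
      exact mono_ne_zero _
    rw [IsScalarTower.algebraMap_apply R S, IsScalarTower.algebraMap_apply R S _ v, hu, hv,
      Algebra.smul_def, Algebra.smul_def, map_mul, map_mul, ← IsScalarTower.algebraMap_apply R S,
      ← hx, mul_div_mul_left _ _ hx0]
  let e : FractionRing R ≃ₐ[R] FractionRing S := FractionRing.algEquiv R (FractionRing S)
  refine ⟨e.symm.toAlgHom.comp (IsScalarTower.toAlgHom R S (FractionRing S)), ?_⟩
  exact e.symm.injective.comp (IsFractionRing.injective S (FractionRing S))

variable (k R S) in
lemma isS2ification [hR : IsMonoidSeries k monoidR R] [hS : IsMonoidSeries k monoidS S]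
    [IsLocalRing R] : IsS2ification R S := by
  have := hR.isDomain
  have := isNoetherianRing_of_monoidR hR
  have hfin := finite_extension k R S
  refine ⟨exists_algHom_fractionRing k R S, hfin, ?_, fun s _ => ?_⟩
  · have hrad := radical_span_pair_eq (maximalIdeal_eq_gensR k R) zero_notMem_gensR
      (N := 5) (by norm_num) (expo_mem_monoidR_left (dvd_refl 5))
      (expo_mem_monoidR_right (dvd_refl 5))
    exact satisfiesSerre_two_of_regular (ringKrullDim_of_monoidR hR)
      (fun r hr x hx => smul_eq_zero_extension k hr hx)
      (hrad ▸ Ideal.le_radical (Ideal.subset_span (by simp)))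
      (hrad ▸ Ideal.le_radical (Ideal.subset_span (by simp)))
      (isWeaklyRegular_pair_iff.2 (regular_of_radical_eq k hrad))
  -- The ideal contains `X^10` and `Y^10`, so the only prime that can be minimal over it is the
  -- maximal ideal, of height two.
  · rw [Ideal.height_eq_inf_minimalPrimes]
    refine le_iInf₂ fun P hP => ?_
    have := hP.isPrime
    have hPm : P = IsLocalRing.maximalIdeal R :=
      eq_maximalIdeal_of_mem (maximalIdeal_eq_gensR k R) zero_notMem_gensR (N := 10)
        (expo_mem_monoidR_left (by norm_num)) (expo_mem_monoidR_right (by norm_num))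
        (hP.le (smul_mem_range_of_le k (by simp) s)) (hP.le (smul_mem_range_of_le k (by simp) s))
    rw [hPm, height_maximalIdeal_eq_two (ringKrullDim_of_monoidR hR)]

end Extension

/-! ### Hilbert coefficients -/

section Coefficients

variable {k : Type*} [Field k] {R : Type*} [CommRing R] [Algebra R (MvPowerSeries (Fin 2) k)]
  [hR : IsMonoidSeries k monoidR R]

lemma monoIdeal_pairR {N : ℕ} (h : 5 ∣ N) : monoIdeal k R (pairR h) =
    Ideal.span {mono k monoidR R ⟨_, expo_mem_monoidR_left h⟩,
      mono k monoidR R ⟨_, expo_mem_monoidR_right h⟩} := by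
  rw [monoIdeal, pairR, pairExponents, Set.image_pair]

variable (k R) in
lemma isParameterIdeal_pairR [IsLocalRing R] {N : ℕ} (hN : N ≠ 0) (h : 5 ∣ N) :
    IsParameterIdeal (monoIdeal k R (pairR h)) := by
  refine ⟨2, ringKrullDim_of_monoidR hR, ![mono k monoidR R ⟨_, expo_mem_monoidR_left h⟩,
      mono k monoidR R ⟨_, expo_mem_monoidR_right h⟩], ?_, ?_⟩
  · rw [monoIdeal_pairR, Matrix.range_cons_cons_empty]
  · rw [monoIdeal_pairR]
    exact radical_span_pair_eq (maximalIdeal_eq_gensR k R) zero_notMem_gensR hN _ _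

variable (k R) in
lemma hasHilbertCoeffs_pairR_five [IsLocalRing R] :
    HasHilbertCoeffs (monoIdeal k R (pairR (dvd_refl 5))) (d := 2) ![5, -2, 0] := by
  refine Filter.Eventually.of_forall fun n =>
    ⟨_, length_quotient_pairR_five_pow k R (Nat.le_add_left 1 n), ?_⟩
  rw [Fin.sum_univ_three]
  simp

variable (k R) in
lemma hasHilbertCoeffs_pairR_ten [IsLocalRing R] :
    HasHilbertCoeffs (monoIdeal k R (pairR (N := 10) (by norm_num))) (d := 2) ![20, -4, 0] := by
  refine Filter.Eventually.of_forall fun n =>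
    ⟨_, length_quotient_pairR_ten_pow k R (Nat.le_add_left 1 n), ?_⟩
  rw [Fin.sum_univ_three]
  simp

variable (k R) in
lemma hasTightHilbertCoeffs_pairR_five [IsLocalRing R] (p : ℕ) [Fact p.Prime] [CharP k p]
    [CharP R p] :
    HasTightHilbertCoeffs p (monoIdeal k R (pairR (dvd_refl 5))) (d := 2) ![5, 0, -4] := by
  -- The coefficient at `n` concerns `Q^(n+1)`, and the closed formula is valid from the second
  -- power on.
  refine (Filter.eventually_ge_atTop 1).mono fun n hn =>
    ⟨_, length_quotient_tightClosure_pow k R p (Nat.succ_le_succ hn), ?_⟩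
  have h : 1 ≤ (n + 1 + 1).choose 2 := Nat.choose_pos (by omega)
  rw [Fin.sum_univ_three, Nat.cast_sub (by omega)]
  simp
  ring

variable (k R) in
lemma length_quotient_pairR_five [IsLocalRing R] :
    Module.length R (R ⧸ monoIdeal k R (pairR (dvd_refl 5))) = (7 : ℕ) := by
  have h := length_quotient_pairR_five_pow k R le_rfl
  rw [pow_one] at h
  exact h

variable (k R) in
lemma length_quotient_pairR_ten [IsLocalRing R] :
    Module.length R (R ⧸ monoIdeal k R (pairR (N := 10) (by norm_num))) = (24 : ℕ) := by
  have h := length_quotient_pairR_ten_pow k R le_rfl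
  rw [pow_one] at h
  exact h

variable (k R) in
-- The parameter ideal `(X^5, Y^5)` has colength 7, while its tight closure has colength 3.
lemma not_isFRational [IsLocalRing R] (p : ℕ) [Fact p.Prime] [CharP k p] [CharP R p] :
    ¬ IsFRational R p := by
  intro h
  have h3 := length_quotient_tightClosure_one k R p
  rw [h _ (isParameterIdeal_pairR k R (by norm_num) (dvd_refl 5)),
    length_quotient_pairR_five k R] at h3
  exact absurd h3 (by norm_num)

end Coefficients

/-- The difference `ℓ(R/Q) - e_0(Q)` is `7 - 5 = 2` for `(X^5, Y^5)` and `24 - 20 = 4` for `(X^10,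
Y^10)`. -/
lemma not_isBuchsbaum {k : Type*} [Field k] {R : Type*} [CommRing R]
    [Algebra R (MvPowerSeries (Fin 2) k)] (hR : IsMonoidSeries k monoidR R) [IsLocalRing R] :
    ¬ IsBuchsbaum R := by
  rintro ⟨C, hC⟩
  have h5 := hC _ (isParameterIdeal_pairR k R (by norm_num) (dvd_refl 5)) 2 _ 7
    (ringKrullDim_of_monoidR hR) (hasHilbertCoeffs_pairR_five k R) (length_quotient_pairR_five k R)
  have h10 := hC _ (isParameterIdeal_pairR k R (N := 10) (by norm_num) (by norm_num)) 2 _ 24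
    (ringKrullDim_of_monoidR hR) (hasHilbertCoeffs_pairR_ten k R) (length_quotient_pairR_ten k R)
  simp at h5 h10
  omega

/-! ### The rings `R` and `S` -/

lemma isScalarTower_inclusion {k T : Type*} [CommRing k] [CommRing T] [Algebra k T]
    {A B : Subalgebra k T} (h : A ≤ B) :
    letI : Algebra A B := (Subalgebra.inclusion h).toRingHom.toAlgebra
    IsScalarTower A B T :=
  letI : Algebra A B := (Subalgebra.inclusion h).toRingHom.toAlgebra
  IsScalarTower.of_algebraMap_eq fun _ => rfl

instance (p : ℕ) : IsScalarTower (ringR p) (ringS p) (MvPowerSeries (Fin 2) (ZMod p)) :=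
  isScalarTower_inclusion (ringR_le_ringS p)

/-- `mono` is a chosen element known only through its image; injectivity identifies it with the
explicit monomials of the statement. -/
lemma monoR_eq_mono (p : ℕ) [Fact p.Prime] {a b : ℕ} (h : expo a b ∈ monoidR) :
    monoR p a b h = mono (ZMod p) monoidR (ringR p) ⟨_, h⟩ := by
  apply IsMonoidSeries.injective (k := ZMod p) (H := monoidR)
  rw [map_mono]
  change (X 0 ^ a * X 1 ^ b : MvPowerSeries (Fin 2) (ZMod p)) = _
  rw [X_pow_eq, X_pow_eq, monomial_mul_monomial, mul_one]
  rfl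

lemma idealQ_eq (p : ℕ) [Fact p.Prime] :
    idealQ p = monoIdeal (ZMod p) (ringR p) (pairR (dvd_refl 5)) := by
  rw [monoIdeal_pairR, idealQ, x5, y5, monoR_eq_mono, monoR_eq_mono]

lemma maximalIdeal_eq_span (p : ℕ) [Fact p.Prime] :
    IsLocalRing.maximalIdeal (ringR p) = Ideal.span {x5 p, x4y p, xy4 p, y5 p} := by
  rw [maximalIdeal_eq_gensR (ZMod p) (ringR p), monoIdeal, x5, x4y, xy4, y5, monoR_eq_mono,
    monoR_eq_mono, monoR_eq_mono, monoR_eq_mono, gensR]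
  simp only [Set.image_insert_eq, Set.image_singleton]

end TightHilbert

open TightHilbert
theorem mainTheorem5 (p : ℕ) [Fact p.Prime] :
    -- `R` is a complete Noetherian local domain of dimension two (hence excellent, reduced, unmixed)
    IsDomain (ringR p) ∧ IsNoetherianRing (ringR p) ∧
    IsLocalRing.maximalIdeal (ringR p) = Ideal.span {x5 p, x4y p, xy4 p, y5 p} ∧
    IsAdicComplete (IsLocalRing.maximalIdeal (ringR p)) (ringR p) ∧
    ringKrullDim (ringR p) = 2 ∧
    -- its `S_2`-ification is `S`
    ringKrullDim (ringS p) = 2 ∧ IsS2ification (ringR p) (ringS p) ∧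
    -- it is neither `(S_2)` nor Buchsbaum, but generalized Cohen-Macaulay
    ¬ SatisfiesSerre (ringR p) 2 (ringR p) ∧
    ¬ IsBuchsbaum (ringR p) ∧
    IsGeneralizedCohenMacaulay (ringR p) ∧
    -- `Q` is a parameter ideal with `e_0(Q) - ℓ(R / Q^*) + e_1(Q) = 0` and
    -- `ℓ(R / (Q ^ (n + 1))^*) = e_0(Q) * (n + 2).choose 2 - 4` for `n ≫ 0`; so `e_1^*(Q) = 0`
    IsParameterIdeal (idealQ p) ∧
    (∃ (e eStar : Fin (2 + 1) → ℤ) (l : ℕ),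
      HasHilbertCoeffs (idealQ p) e ∧
      HasTightHilbertCoeffs p (idealQ p) eStar ∧
      Module.length (ringR p) (ringR p ⧸ tightClosure p (idealQ p)) = l ∧
      e 0 - (l : ℤ) + e 1 = 0 ∧
      eStar 0 = e 0 ∧ eStar 1 = 0 ∧ eStar 2 = -4) ∧
    -- but `R` is not `F`-rational
    ¬ IsFRational (ringR p) p := by
  have hR : IsMonoidSeries (ZMod p) monoidR (ringR p) := inferInstance
  have hS : IsMonoidSeries (ZMod p) monoidS (ringS p) := inferInstance
  refine ⟨hR.isDomain, isNoetherianRing_of_monoidR hR, maximalIdeal_eq_span p, ?_,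
    ringKrullDim_of_monoidR hR, ringKrullDim_of_monoidS hS, isS2ification (ZMod p) _ _,
    not_satisfiesSerre_two (ZMod p) _ (ringS p), not_isBuchsbaum hR,
    isGeneralizedCohenMacaulay (ZMod p) _ (ringS p), ?_, ?_, not_isFRational (ZMod p) _ p⟩
  · rw [maximalIdeal_eq_gensR (ZMod p) (ringR p)]
    exact isAdicComplete_monoIdeal gensR_finite zero_notMem_gensR
  · rw [idealQ_eq]
    exact isParameterIdeal_pairR (ZMod p) _ (by norm_num) _
  · rw [idealQ_eq]
    exact ⟨![5, -2, 0], ![5, 0, -4], 3, hasHilbertCoeffs_pairR_five (ZMod p) _,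
      hasTightHilbertCoeffs_pairR_five (ZMod p) _ p, length_quotient_tightClosure_one (ZMod p) _ p,
      by simp, by simp, by simp, by simp⟩
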